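/- Let $k$ be a commutative ring with unit, $\mathcal{A}$ an associative unital (not necessarily commutative) $k$-algebra, $R$ a commutative unital $k$-algebra and $\phi:\mathcal{A}\to R$ a $k$-linear map with $\phi(1_{\mathcal{A}})=1_R$ (so $(\mathcal{A},\phi)$ is a non-commutative $R$-$k$-probability space). Notation. $\operatorname{NC}(n)$ is the set of non-crossing partitions of $\{1,\dots,n\}$, ordered by refinement ($\sigma\le\pi$ if every block of $\sigma$ is contained in a block of $\pi$). The Kreweras complement $K(\pi)$ of $\pi\in\operatorname{NC}(n)$ is the largest non-crossing partition of $\{\bar 1,\dots,\bar n\}\cong\{1,\dots,n\}$ such that $\pi\cup K(\pi)$ is a non-crossing partition of $1<\bar 1<2<\bar 2<\dots<n<\bar n$. The free cumulants $\kappa_n:\mathcal{A}^n\to R$, $n\ge 1$, are defined recursively by $$\phi(a_1\cdots a_n)=\sum_{\pi\in\operatorname{NC}(n)}\ \prod_{V=\{v_1<\dots<v_m\}\in\pi}\kappa_m(a_{v_1},\dots,a_{v_m}).$$ Subsets $M_1,\dots,M_r\subseteq\mathcal{A}$ are combinatorially free if $\kappa_m(a_1,\dots,a_m)=0$ whenever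 $a_1\in M_{i_1},\dots,a_m\in M_{i_m}$ and $i_p\ne i_q$ for some $1\le p<q\le m$. For $s\in\mathbb{N}$ let $R_+\langle\langle z_1,\dots,z_s\rangle\rangle$ be the $R$-module of formal power series without constant term in the non-commuting indeterminates $z_1,\dots,z_s$. The $\mathcal{R}$-transform of $\underline{a}=(a_1,\dots,a_s)\in\mathcal{A}^s$ is $$\mathcal{R}(\underline{a})=\sum_{n\ge1}\ \sum_{i_1,\dots,i_n=1}^s\kappa_n(a_{i_1},\dots,a_{i_n})\,z_{i_1}\cdots z_{i_n}\in R_+\langle\langle z_1,\dots,z_s\rangle\rangle.$$ For $f\in R_+\langle\langle z_1,\dots,z_s\rangle\rangle$, a word $w=(i_1\dots i_n)$ with $n\ge1$ and $\pi\in\operatorname{NC}(n)$, let $f_w$ be the coefficient of $z_{i_1}\cdots z_{i_n}$ in $f$ and $f_{w,\pi}=\prod_{V\in\pi}f_{w|V}$, where $w|V=(i_{v_1}\dots i_{v_m})$ for $V=\{v_1<\dots<v_m\}$. The boxed convolution $f\boxtimes g\in R_+\langle\langle z_1,\dots,z_s\rangle\rangle$ is defined by $$(f\boxtimes g)_w=\sum_{\pi\in\operatorname{NC}(n)}f_{w,\pi}\,g_{w,K(\pi)}\qquad\text{for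 all words } w \text{ of length } n\ge1.$$ Proposition. Let $\underline{a}=(a_1,\dots,a_s)$ and $\underline{b}=(b_1,\dots,b_s)$ in $\mathcal{A}^s$ be such that the sets $\{a_1,\dots,a_s\}$ and $\{b_1,\dots,b_s\}$ are combinatorially free. Put $\underline{a}+\underline{b}=(a_1+b_1,\dots,a_s+b_s)$ and $\underline{a}\star\underline{b}=(a_1b_1,\dots,a_sb_s)$. Then $$\mathcal{R}(\underline{a}+\underline{b})=\mathcal{R}(\underline{a})+\mathcal{R}(\underline{b})\qquad\text{and}\qquad\mathcal{R}(\underline{a}\star\underline{b})=\mathcal{R}(\underline{a})\boxtimes\mathcal{R}(\underline{b}).$$ -/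

import Mathlib

/-! ## Non-crossing partitions and the Kreweras complement -/

/-- `p` and `q` lie in a common block of the partition `π`. -/
def SameBlock {α : Type*} [DecidableEq α] {S : Finset α} (π : Finpartition S) (p q : α) : Prop :=
  ∃ V ∈ π.parts, p ∈ V ∧ q ∈ V

/-- A partition of a finite subset of a totally ordered set is non-crossing if there are no
`p₁ < q₁ < p₂ < q₂` with `p₁ ∼ p₂`, `q₁ ∼ q₂` and `p₂ ≁ q₁`. -/
def IsNonCrossing {α : Type*} [LinearOrder α] {S : Finset α} (π : Finpartition S) : Prop :=
  ∀ p₁ q₁ p₂ q₂ : α, p₁ < q₁ → q₁ < p₂ → p₂ < q₂ →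
    SameBlock π p₁ p₂ → SameBlock π q₁ q₂ → SameBlock π p₂ q₁

/-- The non-crossing partitions of `{1, …, n}`, ordered by refinement: `σ ≤ π` if every block of
`σ` is contained in some block of `π`. -/
abbrev NC (n : ℕ) : Type :=
  {π : Finpartition (Finset.univ : Finset (Fin n)) // IsNonCrossing π}

noncomputable instance instFintypeNC (n : ℕ) : Fintype (NC n) := Fintype.ofFinite _

/-- The ordered set `1 < 1̄ < 2 < 2̄ < ⋯ < n < n̄`: the element `(i, 0)` stands for `i` and
`(i, 1)` for `ī`. -/
abbrev Doubled (n : ℕ) : Type := Fin n ×ₗ Fin 2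

/-- The copy `i ↦ (i, c)` of `{1, …, n}` inside the doubled set. -/
def inCopy {n : ℕ} (c : Fin 2) : Fin n ↪ Doubled n where
  toFun i := toLex (i, c)
  inj' i j h := by
    have h' := congrArg (fun x => (ofLex x).1) h
    simpa using h'

theorem toLex_mem_map_inCopy {n : ℕ} (i : Fin n) (c d : Fin 2) (V : Finset (Fin n)) :
    toLex (i, c) ∈ V.map (inCopy d) ↔ c = d ∧ i ∈ V := by
  rw [Finset.mem_map]
  constructor
  · rintro ⟨j, hj, h⟩
    have h' : (j, d) = (i, c) := toLex.injective h
    obtain ⟨rfl, rfl⟩ := Prod.mk.inj h'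
    exact ⟨rfl, hj⟩
  · rintro ⟨rfl, hi⟩
    exact ⟨i, hi, rfl⟩

/-- The partition `π ∪ σ` of the doubled set, `π` being placed on `{1, …, n}` and `σ` on
`{1̄, …, n̄}`. -/
def unionPartition {n : ℕ} (π σ : Finpartition (Finset.univ : Finset (Fin n))) :
    Finpartition (Finset.univ : Finset (Doubled n)) :=
  Finpartition.ofExistsUnique
    (π.parts.image (fun V => V.map (inCopy 0)) ∪ σ.parts.image (fun V => V.map (inCopy 1)))
    (fun _ _ => Finset.subset_univ _)
    (by
      intro x _
      obtain ⟨⟨i, c⟩, rfl⟩ := toLex.surjective x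
      have key : ∀ (d : Fin 2) (V : Finset (Fin n)),
          toLex (i, c) ∈ V.map (inCopy d) ↔ d = c ∧ i ∈ V := by
        intro d V
        rw [toLex_mem_map_inCopy, eq_comm]
      simp only [Finset.mem_union, Finset.mem_image]
      fin_cases c
      · obtain ⟨V, hV, hi⟩ := π.exists_mem (Finset.mem_univ i)
        refine ⟨V.map (inCopy 0), ⟨Or.inl ⟨V, hV, rfl⟩, (key _ _).2 ⟨rfl, hi⟩⟩, ?_⟩
        rintro W ⟨⟨W, hW, rfl⟩ | ⟨W, hW, rfl⟩, hx⟩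
        · rw [π.eq_of_mem_parts hW hV ((key _ _).1 hx).2 hi]
        · exact absurd ((key _ _).1 hx).1 (by simp)
      · obtain ⟨V, hV, hi⟩ := σ.exists_mem (Finset.mem_univ i)
        refine ⟨V.map (inCopy 1), ⟨Or.inr ⟨V, hV, rfl⟩, (key _ _).2 ⟨rfl, hi⟩⟩, ?_⟩
        rintro W ⟨⟨W, hW, rfl⟩ | ⟨W, hW, rfl⟩, hx⟩
        · exact absurd ((key _ _).1 hx).1 (by simp)
        · rw [σ.eq_of_mem_parts hW hV ((key _ _).1 hx).2 hi])
    (by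
      simp only [Finset.mem_union, Finset.mem_image, Finset.map_eq_empty, not_or, not_exists,
        not_and]
      exact ⟨fun V hV h => π.ne_empty hV h, fun V hV h => σ.ne_empty hV h⟩)

theorem sameBlock_unionPartition {n : ℕ} (π σ : Finpartition (Finset.univ : Finset (Fin n)))
    (i j : Fin n) (c d : Fin 2) :
    SameBlock (unionPartition π σ) (toLex (i, c)) (toLex (j, d)) ↔
      (c = 0 ∧ d = 0 ∧ SameBlock π i j) ∨ (c = 1 ∧ d = 1 ∧ SameBlock σ i j) := by
  have key := @toLex_mem_map_inCopy n
  simp only [SameBlock, unionPartition, Finpartition.ofExistsUnique, Finset.mem_union,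
    Finset.mem_image]
  constructor
  · rintro ⟨_, ⟨V, hV, rfl⟩ | ⟨V, hV, rfl⟩, h1, h2⟩
    · rw [key] at h1 h2
      exact Or.inl ⟨h1.1, h2.1, V, hV, h1.2, h2.2⟩
    · rw [key] at h1 h2
      exact Or.inr ⟨h1.1, h2.1, V, hV, h1.2, h2.2⟩
  · rintro (⟨hc, hd, V, hV, h1, h2⟩ | ⟨hc, hd, V, hV, h1, h2⟩)
    · exact ⟨_, Or.inl ⟨V, hV, rfl⟩, (key _ _ _ _).2 ⟨hc, h1⟩, (key _ _ _ _).2 ⟨hd, h2⟩⟩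
    · exact ⟨_, Or.inr ⟨V, hV, rfl⟩, (key _ _ _ _).2 ⟨hc, h1⟩, (key _ _ _ _).2 ⟨hd, h2⟩⟩

/-- Among the `σ` for which `π ∪ σ` is non-crossing there is a largest one. It also has the
explicit description: `i` and `j` lie in the same block iff they separate the same pairs `x`, `y`
of elements of a block of `π`. -/
theorem exists_kreweras {n : ℕ} (π : NC n) :
    ∃ κ : NC n, IsGreatest {σ : NC n | IsNonCrossing (unionPartition π.1 σ.1)} κ ∧
      ∀ i j : Fin n, SameBlock κ.1 i j ↔
        ∀ x y, SameBlock π.1 x y → ((i < x ↔ i < y) ↔ (j < x ↔ j < y)) := by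
  classical
  let s : Setoid (Fin n) :=
    { r := fun i j => ∀ x y, SameBlock π.1 x y → ((i < x ↔ i < y) ↔ (j < x ↔ j < y))
      iseqv := ⟨fun _ _ _ _ => Iff.rfl, fun h x y hxy => (h x y hxy).symm,
        fun h h' x y hxy => (h x y hxy).trans (h' x y hxy)⟩ }
  have hs : ∀ i j, SameBlock (Finpartition.ofSetoid s) i j ↔
      ∀ x y, SameBlock π.1 x y → ((i < x ↔ i < y) ↔ (j < x ↔ j < y)) := by
    intro i j
    have h1 := Finpartition.mem_part_iff_exists (Finpartition.ofSetoid s) (a := i) (b := j)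
    have h2 := Finpartition.mem_part_ofSetoid_iff_rel (s := s) (a := j) (b := i)
    rw [SameBlock, ← h1, h2]
    exact ⟨fun h => s.symm h, fun h => s.symm h⟩
  have hπsymm : ∀ x y, SameBlock π.1 x y → SameBlock π.1 y x := by
    rintro x y ⟨V, hV, h1, h2⟩; exact ⟨V, hV, h2, h1⟩
  have hnc : IsNonCrossing (Finpartition.ofSetoid s) := by
    intro p₁ q₁ p₂ q₂ h1 h2 h3 hp hq
    rw [hs] at hp hq ⊢
    intro x y hxy
    have := hp x y hxy
    have := hq x y hxy
    grind
  refine ⟨⟨Finpartition.ofSetoid s, hnc⟩, ⟨?_, ?_⟩, hs⟩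
  · intro p₁ q₁ p₂ q₂ h1 h2 h3 hp hq
    obtain ⟨⟨p₁, c₁⟩, rfl⟩ := toLex.surjective p₁
    obtain ⟨⟨q₁, d₁⟩, rfl⟩ := toLex.surjective q₁
    obtain ⟨⟨p₂, c₂⟩, rfl⟩ := toLex.surjective p₂
    obtain ⟨⟨q₂, d₂⟩, rfl⟩ := toLex.surjective q₂
    rw [sameBlock_unionPartition] at hp hq ⊢
    rw [Prod.Lex.toLex_lt_toLex] at h1 h2 h3
    rcases hp with ⟨rfl, rfl, hp⟩ | ⟨rfl, rfl, hp⟩ <;>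
      rcases hq with ⟨rfl, rfl, hq⟩ | ⟨rfl, rfl, hq⟩
    · simp only [lt_irrefl, and_false, or_false] at h1 h2 h3
      exact Or.inl ⟨rfl, rfl, π.2 _ _ _ _ h1 h2 h3 hp hq⟩
    · exfalso
      have := (hs _ _).1 hq _ _ hp
      simp at h1 h2 h3
      grind
    · exfalso
      have := (hs _ _).1 hp _ _ hq
      simp at h1 h2 h3
      grind
    · simp only [lt_irrefl, and_false, or_false] at h1 h2 h3
      exact Or.inr ⟨rfl, rfl, hnc _ _ _ _ h1 h2 h3 hp hq⟩
  · intro σ hσ V hV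
    obtain ⟨i, hi⟩ := σ.1.nonempty_of_mem_parts hV
    refine ⟨(Finpartition.ofSetoid s).part i,
      (Finpartition.part_mem _).2 (Finset.mem_univ i), ?_⟩
    intro j hj
    rw [Finpartition.mem_part_ofSetoid_iff_rel]
    have main : ∀ i j, i ∈ V → j ∈ V → i < j → s i j := by
      intro i j hi hj hij
      have hij' : SameBlock σ.1 i j := ⟨V, hV, hi, hj⟩
      have sep : ∀ x y, SameBlock π.1 x y → x < y →
          ((i < x ↔ i < y) ↔ (j < x ↔ j < y)) := by
        intro x y hxy hlt
        by_contra hcon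
        have hcase : (x ≤ i ∧ i < y ∧ y ≤ j) ∨ (i < x ∧ x ≤ j ∧ j < y) := by grind
        rcases hcase with ⟨h1, h2, h3⟩ | ⟨h1, h2, h3⟩
        · have := hσ (toLex (x, 0)) (toLex (i, 1)) (toLex (y, 0)) (toLex (j, 1))
            (by rw [Prod.Lex.toLex_lt_toLex]; simp; grind)
            (by rw [Prod.Lex.toLex_lt_toLex]; simp; grind)
            (by rw [Prod.Lex.toLex_lt_toLex]; simp; grind)
            ((sameBlock_unionPartition _ _ _ _ _ _).2 (Or.inl ⟨rfl, rfl, hxy⟩))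
            ((sameBlock_unionPartition _ _ _ _ _ _).2 (Or.inr ⟨rfl, rfl, hij'⟩))
          rw [sameBlock_unionPartition] at this
          simp at this
        · have := hσ (toLex (i, 1)) (toLex (x, 0)) (toLex (j, 1)) (toLex (y, 0))
            (by rw [Prod.Lex.toLex_lt_toLex]; simp; grind)
            (by rw [Prod.Lex.toLex_lt_toLex]; simp; grind)
            (by rw [Prod.Lex.toLex_lt_toLex]; simp; grind)
            ((sameBlock_unionPartition _ _ _ _ _ _).2 (Or.inr ⟨rfl, rfl, hij'⟩))
            ((sameBlock_unionPartition _ _ _ _ _ _).2 (Or.inl ⟨rfl, rfl, hxy⟩))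
          rw [sameBlock_unionPartition] at this
          simp at this
      intro x y hxy
      rcases lt_trichotomy x y with h | rfl | h
      · exact sep x y hxy h
      · simp
      · have := sep y x (hπsymm _ _ hxy) h
        grind
    rcases lt_trichotomy i j with h | rfl | h
    · exact main _ _ hi hj h
    · exact s.refl _
    · exact s.symm (main _ _ hj hi h)

/-- The Kreweras complement `K(π)`: the largest non-crossing partition of `{1̄, …, n̄}`, which is
identified with `{1, …, n}`, such that `π ∪ K(π)` is a non-crossing partition of the doubled
set. -/
noncomputable def kreweras {n : ℕ} (π : NC n) : NC n := (exists_kreweras π).choose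

theorem kreweras_isGreatest {n : ℕ} (π : NC n) :
    IsGreatest {σ : NC n | IsNonCrossing (unionPartition π.1 σ.1)} (kreweras π) :=
  (exists_kreweras π).choose_spec.1

theorem sameBlock_kreweras {n : ℕ} (π : NC n) (i j : Fin n) :
    SameBlock (kreweras π).1 i j ↔
      ∀ x y, SameBlock π.1 x y → ((i < x ↔ i < y) ↔ (j < x ↔ j < y)) :=
  (exists_kreweras π).choose_spec.2 i j

/-- The restriction of a sequence `(x₁, …, xₙ)` to `V = {v₁ < ⋯ < v_m}`, that is,
`(x_{v₁}, …, x_{v_m})`. -/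
def restrictTo {n : ℕ} {X : Type*} (x : Fin n → X) (V : Finset (Fin n)) : Fin V.card → X :=
  fun j => x (V.orderEmbOfFin rfl j)

/-! ## Probability spaces, free cumulants, combinatorial freeness -/

/-- The functional of a non-commutative `R`-valued `k`-probability space `(A, φ)`: a unital
`k`-linear map from the `k`-algebra `A` to the commutative `k`-algebra `R`. -/
structure NCProbability (k A R : Type*) [CommRing k] [Ring A] [Algebra k A] [CommRing R]
    [Algebra k R] where
  φ : A →ₗ[k] R
  map_one : φ 1 = 1

theorem card_lt_of_mem_parts_of_ne_top {n : ℕ}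
    {π : Finpartition (Finset.univ : Finset (Fin n))} (h : π ≠ ⊤) {V : Finset (Fin n)}
    (hV : V ∈ π.parts) : V.card < n := by
  have hle : V.card ≤ n := by simpa using V.card_le_univ
  rcases hle.lt_or_eq with h' | h'
  · exact h'
  · exfalso
    have hVu : V = Finset.univ := by
      rw [← Finset.card_eq_iff_eq_univ]; simpa using h'
    apply h
    refine le_antisymm le_top ?_
    intro W hW
    have hW' := Finpartition.parts_top_subset _ hW
    rw [Finset.mem_singleton] at hW'
    exact ⟨V, hV, by simp [hW', hVu]⟩

section Cumulants

variable {k A R : Type*} [CommRing k] [Ring A] [Algebra k A] [CommRing R] [Algebra k R]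

/-- The free cumulants `κₙ(a₁, …, aₙ)`, by the recursion which results from solving the
moment-cumulant formula `φ(a₁ ⋯ aₙ) = ∑_{π ∈ NC(n)} κ_π[a₁, …, aₙ]` for the summand of the
partition `⊤` with a single block. -/
noncomputable def freeCumulant (P : NCProbability k A R) : (n : ℕ) → (Fin n → A) → R
  | n, a => P.φ (List.ofFn a).prod -
      ∑ π : {π : NC n // π.1 ≠ ⊤}, ∏ V : {V : Finset (Fin n) // V ∈ π.1.1.parts},
        freeCumulant P V.1.card (restrictTo a V.1)
  termination_by n => n
  decreasing_by exact card_lt_of_mem_parts_of_ne_top π.2 V.2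

/-- `κ_π[a₁, …, aₙ]`, the product over the blocks `V` of `π` of the cumulants of the
restrictions of `(a₁, …, aₙ)` to `V`. -/
noncomputable def partitionCumulant (P : NCProbability k A R) {n : ℕ} (π : NC n)
    (a : Fin n → A) : R :=
  ∏ V ∈ π.1.parts, freeCumulant P V.card (restrictTo a V)

theorem isNonCrossing_top (n : ℕ) :
    IsNonCrossing (⊤ : Finpartition (Finset.univ : Finset (Fin n))) := by
  intro p₁ q₁ p₂ q₂ _ _ _ hp hq
  obtain ⟨V, hV, _, h2⟩ := hp
  obtain ⟨W, hW, h3, _⟩ := hq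
  exact ⟨V, hV, h2, by rwa [Finpartition.parts_top_subsingleton _ hV hW]⟩

/-- The moment-cumulant formula, which determines the free cumulants. -/
theorem moment_cumulant_formula (P : NCProbability k A R) {n : ℕ} (hn : 1 ≤ n)
    (a : Fin n → A) : P.φ (List.ofFn a).prod = ∑ π : NC n, partitionCumulant P π a := by
  classical
  have htop : partitionCumulant P ⟨⊤, isNonCrossing_top n⟩ a = freeCumulant P n a := by
    have hne : (Finset.univ : Finset (Fin n)) ≠ ⊥ := by
      have : Nonempty (Fin n) := ⟨⟨0, hn⟩⟩
      exact Finset.univ_nonempty.ne_empty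
    have hparts : (⊤ : Finpartition (Finset.univ : Finset (Fin n))).parts = {Finset.univ} := by
      apply Finset.Subset.antisymm (Finpartition.parts_top_subset _)
      have hne' := Finpartition.parts_nonempty
        (⊤ : Finpartition (Finset.univ : Finset (Fin n))) hne
      obtain ⟨V, hV⟩ := hne'
      have hVu := Finset.mem_singleton.1 (Finpartition.parts_top_subset _ hV)
      rw [Finset.singleton_subset_iff]
      exact hVu ▸ hV
    have hcast : ∀ (m : ℕ) (h : (Finset.univ : Finset (Fin n)).card = m) (hm : m = n),
        freeCumulant P m (fun j => a ((Finset.univ : Finset (Fin n)).orderEmbOfFin h j)) =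
          freeCumulant P n a := by
      rintro m h rfl
      congr 1
      funext j
      congr 1
      have := Finset.orderEmbOfFin_unique' h (f := RelEmbedding.refl (· ≤ ·))
        (fun x => Finset.mem_univ _)
      rw [← this]
      rfl
    rw [partitionCumulant]
    simp only [hparts, Finset.prod_singleton]
    exact hcast _ rfl (by simp)
  have hsum : ∑ π : NC n, partitionCumulant P π a =
      partitionCumulant P ⟨⊤, isNonCrossing_top n⟩ a +
      ∑ π : {π : NC n // π.1 ≠ ⊤}, partitionCumulant P π.1 a := by
    rw [← Finset.add_sum_erase _ _ (Finset.mem_univ (⟨⊤, isNonCrossing_top n⟩ : NC n))]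
    congr 1
    refine Finset.sum_subtype _ (fun π => ?_) _
    rw [Finset.mem_erase]
    simp [Subtype.ext_iff]
  have hprod : ∀ π : NC n, partitionCumulant P π a =
      ∏ V : {V : Finset (Fin n) // V ∈ π.1.parts},
        freeCumulant P V.1.card (restrictTo a V.1) := by
    intro π
    rw [partitionCumulant]
    exact (Finset.prod_coe_sort π.1.parts
      (fun V => freeCumulant P V.card (restrictTo a V))).symm
  rw [hsum, htop, freeCumulant]
  simp only [hprod]
  abel

/-- Subsets `M₁, …, M_r` of `A` are combinatorially free if their mixed cumulants vanish. -/
def CombinatoriallyFree (P : NCProbability k A R) {r : ℕ} (M : Fin r → Set A) : Prop :=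
  ∀ (m : ℕ) (a : Fin m → A) (i : Fin m → Fin r), (∀ j, a j ∈ M (i j)) →
    (∃ p q : Fin m, p < q ∧ i p ≠ i q) → freeCumulant P m a = 0

end Cumulants

/-! ## Power series without constant term, the R-transform and boxed convolution -/

/-- The formal power series without constant term in `s` non-commuting indeterminates over `R`,
as the `R`-module of coefficient families `w ↦ f_w` indexed by the words `w` over an alphabet
with `s` letters, with vanishing coefficient at the empty word. -/
def NCSeriesPlus (R : Type*) [CommRing R] (s : ℕ) : Submodule R (List (Fin s) → R) where
  carrier := {f | f [] = 0}
  add_mem' := by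
    intro f g hf hg
    simp only [Set.mem_ofPred_eq, Pi.add_apply] at *
    simp [hf, hg]
  zero_mem' := rfl
  smul_mem' := by
    intro c f hf
    simp only [Set.mem_ofPred_eq, Pi.smul_apply] at *
    simp [hf]

/-- The R-transform of `(a₁, …, a_s)`: the coefficient at a word `w = (i₁ … iₙ)` with `n ≥ 1` is
`κₙ(a_{i₁}, …, a_{iₙ})`. -/
noncomputable def RTransform {k A R : Type*} [CommRing k] [Ring A] [Algebra k A] [CommRing R]
    [Algebra k R] (P : NCProbability k A R) {s : ℕ} (a : Fin s → A) : NCSeriesPlus R s :=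
  ⟨fun w => if w = [] then 0 else freeCumulant P w.length (fun j => a (w.get j)), if_pos rfl⟩

/-- `X_{w,π}(f)`, the product over the blocks `V` of `π` of the coefficients of `f` at the
restrictions `w|V`. -/
noncomputable def coeffAlong {R : Type*} [CommRing R] {s : ℕ} (f : NCSeriesPlus R s)
    (w : List (Fin s)) (π : NC w.length) : R :=
  ∏ V ∈ π.1.parts, f.1 (List.ofFn (restrictTo w.get V))

/-- The boxed convolution: `(f ⊠ g)_w = ∑_{π ∈ NC(|w|)} f_{w,π} g_{w,K(π)}` for every non-empty
word `w`. -/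
noncomputable def boxedConvolution {R : Type*} [CommRing R] {s : ℕ} (f g : NCSeriesPlus R s) :
    NCSeriesPlus R s :=
  ⟨fun w => if w = [] then 0
    else ∑ π : NC w.length, coeffAlong f w π * coeffAlong g w (kreweras π), if_pos rfl⟩

/-! Sums: the moment-cumulant formula makes each $\kappa_n$ multilinear by induction on $n$, so
$\kappa_n(a_{i_1}+b_{i_1},\dots)$ expands over subsets of positions, and freeness kills all terms
but the pure ones (`freeCumulant_add_of_free`).

Products: a family of functions is determined by its sums over $\operatorname{NC}(n)$ of products
over blocks, since $\top$ contributes the $n$-th function and all other blocks are smaller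
(`eq_of_sumNC_eq`). It therefore suffices to compare these sums for the two sides. For the cumulants
of the products the sum is the moment $\phi(a_{i_1}b_{i_1}\cdots a_{i_n}b_{i_n})$, a sum over
non-crossing partitions of the doubled set. By freeness only the partitions $\pi\cup\sigma$ survive,
that is, the compatible pairs $(\pi,\sigma)$ (`sum_doubled`). For the boxed convolution the sum runs
over $\rho$ and, for each block $V$ of $\rho$, over a $\pi_V\in\operatorname{NC}(V)$ weighted
together with $K(\pi_V)$. Gluing the $\pi_V$ and the $K(\pi_V)$ gives a bijection onto the
compatible pairs, with inverse $\rho=\pi\vee\sigma$, $\pi_V=\pi|_V$ (`sum_prod_relKreweras`).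

The bijection rests on two facts: $\pi$ and $K(\pi)$ together connect the ground set
(`connected_relKreweras`), and $K(\pi)$ is the only non-crossing partition compatible with $\pi$
that does so (`eq_relKreweras_of_connected`). -/

/-! ## Partitions through their block relation -/

section BlockRelation

variable {α : Type*} [DecidableEq α] {S : Finset α}

theorem SameBlock.symm {π : Finpartition S} {x y : α} (h : SameBlock π x y) :
    SameBlock π y x := by
  obtain ⟨V, hV, h1, h2⟩ := h
  exact ⟨V, hV, h2, h1⟩

theorem SameBlock.trans {π : Finpartition S} {x y z : α} (h : SameBlock π x y)
    (h' : SameBlock π y z) : SameBlock π x z := by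
  obtain ⟨V, hV, h1, h2⟩ := h
  obtain ⟨W, hW, h3, h4⟩ := h'
  obtain rfl := π.eq_of_mem_parts hV hW h2 h3
  exact ⟨V, hV, h1, h4⟩

theorem SameBlock.left_mem {π : Finpartition S} {x y : α} (h : SameBlock π x y) : x ∈ S := by
  obtain ⟨V, hV, h1, _⟩ := h
  exact π.le hV h1

theorem SameBlock.right_mem {π : Finpartition S} {x y : α} (h : SameBlock π x y) : y ∈ S :=
  h.symm.left_mem

theorem SameBlock.refl (π : Finpartition S) {x : α} (hx : x ∈ S) : SameBlock π x x := by
  obtain ⟨V, hV, h⟩ := π.exists_mem hx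
  exact ⟨V, hV, h, h⟩

theorem mem_parts_iff_sameBlock (π : Finpartition S) (V : Finset α) :
    V ∈ π.parts ↔ ∃ x ∈ S, ∀ y, y ∈ V ↔ SameBlock π x y := by
  constructor
  · intro hV
    obtain ⟨x, hx⟩ := π.nonempty_of_mem_parts hV
    refine ⟨x, π.le hV hx, fun y => ⟨fun hy => ⟨V, hV, hx, hy⟩, ?_⟩⟩
    rintro ⟨W, hW, h1, h2⟩
    rwa [π.eq_of_mem_parts hV hW hx h1]
  · rintro ⟨x, hx, h⟩
    obtain ⟨W, hW, hxW⟩ := π.exists_mem hx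
    suffices V = W by rwa [this]
    ext y
    rw [h]
    constructor
    · rintro ⟨W', hW', h1, h2⟩
      rwa [π.eq_of_mem_parts hW hW' hxW h1]
    · exact fun hy => ⟨W, hW, hxW, hy⟩

theorem finpartition_ext_sameBlock {π σ : Finpartition S}
    (h : ∀ x y, SameBlock π x y ↔ SameBlock σ x y) : π = σ := by
  ext V
  simp only [mem_parts_iff_sameBlock, h]

/-- The partition of `S` into the traces of the classes of an equivalence relation. -/
noncomputable def tracePartition (s : Setoid α) (S : Finset α) : Finpartition S :=
  letI : DecidableRel s.r := Classical.decRel _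
  Finpartition.ofSetSetoid s S

theorem sameBlock_tracePartition (s : Setoid α) (S : Finset α) (x y : α) :
    SameBlock (tracePartition s S) x y ↔ x ∈ S ∧ y ∈ S ∧ s x y := by
  let : DecidableRel s.r := Classical.decRel _
  rw [SameBlock, ← Finpartition.mem_part_iff_exists, tracePartition,
    Finpartition.mem_part_ofSetSetoid_iff_rel]
  exact ⟨fun ⟨h1, h2, h3⟩ => ⟨h2, h1, s.symm h3⟩, fun ⟨h1, h2, h3⟩ => ⟨h2, h1, s.symm h3⟩⟩

/-- An equivalence relation which restricts to the block relation of `π` on `S`. -/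
def blockSetoid (π : Finpartition S) : Setoid α where
  r x y := ∀ V ∈ π.parts, x ∈ V ↔ y ∈ V
  iseqv := ⟨fun _ _ _ => Iff.rfl, fun h V hV => (h V hV).symm,
    fun h h' V hV => (h V hV).trans (h' V hV)⟩

theorem blockSetoid_iff (π : Finpartition S) {x y : α} (hx : x ∈ S) :
    blockSetoid π x y ↔ SameBlock π x y := by
  constructor
  · intro h
    obtain ⟨V, hV, hxV⟩ := π.exists_mem hx
    exact ⟨V, hV, hxV, (h V hV).1 hxV⟩
  · rintro ⟨V, hV, h1, h2⟩ W hW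
    constructor
    · intro h; rwa [π.eq_of_mem_parts hW hV h h1]
    · intro h; rwa [π.eq_of_mem_parts hW hV h h2]

theorem sameBlock_bind (ρ : Finpartition S) (Q : ∀ V ∈ ρ.parts, Finpartition V) (x y : α) :
    SameBlock (ρ.bind Q) x y ↔ ∃ V, ∃ hV : V ∈ ρ.parts, SameBlock (Q V hV) x y := by
  simp only [SameBlock, Finpartition.mem_bind]
  grind

theorem sameBlock_of_sameBlock_bind (ρ : Finpartition S) (Q : ∀ V ∈ ρ.parts, Finpartition V)
    {V : Finset α} (hV : V ∈ ρ.parts) {x y : α} :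
    SameBlock (Q V hV) x y ↔ x ∈ V ∧ SameBlock (ρ.bind Q) x y := by
  rw [sameBlock_bind]
  constructor
  · exact fun h => ⟨h.left_mem, V, hV, h⟩
  · rintro ⟨hx, W, hW, h⟩
    obtain rfl := ρ.eq_of_mem_parts hV hW hx h.left_mem
    exact h

theorem prod_bind_parts {M : Type*} [CommMonoid M] (ρ : Finpartition S)
    (Q : ∀ V ∈ ρ.parts, Finpartition V) (f : Finset α → M) :
    ∏ W ∈ (ρ.bind Q).parts, f W = ∏ V ∈ ρ.parts.attach, ∏ W ∈ (Q V.1 V.2).parts, f W := by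
  rw [Finpartition.bind_parts, Finset.prod_biUnion]
  rintro ⟨b, hb⟩ - ⟨c, hc⟩ - hbc
  rw [Function.onFun, Finset.disjoint_left]
  intro d hdb hdc
  obtain ⟨x, hx⟩ := (Q b hb).nonempty_of_mem_parts hdb
  exact hbc (Subtype.ext (ρ.eq_of_mem_parts hb hc ((Q b hb).le hdb hx) ((Q c hc).le hdc hx)))

end BlockRelation

/-! ## Relative Kreweras complements -/

section Relative

variable {α : Type*} [LinearOrder α] {S : Finset α}

/-- The non-crossing partitions of a finite subset of a totally ordered set. -/
abbrev NCOn (S : Finset α) : Type _ := {π : Finpartition S // IsNonCrossing π}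

noncomputable instance instFintypeNCOn (S : Finset α) : Fintype (NCOn S) := Fintype.ofFinite _

/-- No block of `σ` separates two elements of a block of `π`, when `σ` is placed on the copy of
the ground set in which each `ī` directly follows `i`. -/
def Compatible {T : Finset α} (π : Finpartition S) (σ : Finpartition T) : Prop :=
  ∀ i j, SameBlock σ i j → ∀ x y, SameBlock π x y → ((i < x ↔ i < y) ↔ (j < x ↔ j < y))

/-- `i` and `j` separate the same pairs of elements of blocks of `π`. -/
def separationSetoid (π : Finpartition S) : Setoid α where
  r i j := ∀ x y, SameBlock π x y → ((i < x ↔ i < y) ↔ (j < x ↔ j < y))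
  iseqv := ⟨fun _ _ _ _ => Iff.rfl, fun h x y hxy => (h x y hxy).symm,
    fun h h' x y hxy => (h x y hxy).trans (h' x y hxy)⟩

/-- The Kreweras complement within the subset `S`. -/
noncomputable def relKreweras (π : Finpartition S) : Finpartition S :=
  tracePartition (separationSetoid π) S

theorem sameBlock_relKreweras (π : Finpartition S) (i j : α) :
    SameBlock (relKreweras π) i j ↔ i ∈ S ∧ j ∈ S ∧
      ∀ x y, SameBlock π x y → ((i < x ↔ i < y) ↔ (j < x ↔ j < y)) :=
  sameBlock_tracePartition _ _ _ _

theorem compatible_relKreweras (π : Finpartition S) : Compatible π (relKreweras π) :=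
  fun i j h => ((sameBlock_relKreweras π i j).1 h).2.2

/-- A pair $x\le y$ is separated by $i$ exactly when $x\le i<y$. This is membership in an interval,
so for alternating $p_1<q_1<p_2<q_2$ agreement of the $p$'s and agreement of the $q$'s force all
four to agree. No condition on `π` enters. -/
theorem isNonCrossing_relKreweras (π : Finpartition S) : IsNonCrossing (relKreweras π) := by
  intro p₁ q₁ p₂ q₂ h1 h2 h3 hp hq
  rw [sameBlock_relKreweras] at hp hq ⊢
  refine ⟨hp.2.1, hq.1, fun x y hxy => ?_⟩
  have := hp.2.2 x y hxy
  have := hq.2.2 x y hxy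
  grind

/-- A partition and its Kreweras complement together connect the whole ground set. -/
theorem connected_relKreweras {π : Finpartition S} (hπ : IsNonCrossing π) (r : Setoid α)
    (h1 : ∀ x y, SameBlock π x y → r x y) (h2 : ∀ x y, SameBlock (relKreweras π) x y → r x y)
    {x y : α} (hx : x ∈ S) (hy : y ∈ S) : r x y := by
  classical
  have hne : S.Nonempty := ⟨x, hx⟩
  -- Let `t` be the largest element of `S` in the class of `x`. If some block of `π` crosses from
  -- below to above `t`, the class is shown to reach beyond `t`; otherwise `t` and the maximum of
  -- `S` share a Kreweras block.
  suffices main : ∀ x ∈ S, r x (S.max' hne) from r.trans (main x hx) (r.symm (main y hy))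
  clear hx hy x y
  intro x hx
  have hC : (S.filter (fun y => r x y)).Nonempty := ⟨x, by simp [hx]⟩
  obtain ⟨t, htC, htmax⟩ : ∃ t ∈ S.filter (fun y => r x y),
      ∀ y ∈ S.filter (fun y => r x y), y ≤ t :=
    ⟨_, Finset.max'_mem _ hC, fun y hy => Finset.le_max' _ y hy⟩
  simp only [Finset.mem_filter] at htC htmax
  obtain ⟨htS, hxt⟩ := htC
  by_cases hD : (S.filter (fun u => u ≤ t ∧ ∃ v, t < v ∧ SameBlock π u v)).Nonempty
  · exfalso
    -- With `u` the last point at or below `t` whose block continues past `t`, no block of `π` has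
    -- points both inside and outside `(u, t]`. Hence `u` and `t` share a Kreweras block, and `t`,
    -- `u`, `v` are linked with `v > t`.
    obtain ⟨u, huD, humax⟩ : ∃ u ∈ S.filter (fun u => u ≤ t ∧ ∃ v, t < v ∧ SameBlock π u v),
        ∀ w ∈ S.filter (fun u => u ≤ t ∧ ∃ v, t < v ∧ SameBlock π u v), w ≤ u :=
      ⟨_, Finset.max'_mem _ hD, fun y hy => Finset.le_max' _ y hy⟩
    simp only [Finset.mem_filter] at huD humax
    obtain ⟨huS, hut, v, htv, huv⟩ := huD
    have key : ∀ a b, SameBlock π a b → a ≤ u → b ≤ u ∨ t < b := by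
      intro a b hab hau
      by_contra hcon
      push Not at hcon
      rcases hau.lt_or_eq with h | rfl
      · have := hπ a u b v h hcon.1 (hcon.2.trans_lt htv) hab huv
        have := humax b ⟨hab.right_mem, hcon.2, v, htv, this.trans huv⟩
        exact absurd this (not_le.2 hcon.1)
      · have := humax b ⟨hab.right_mem, hcon.2, v, htv, hab.symm.trans huv⟩
        exact absurd this (not_le.2 hcon.1)
    have key' : ∀ a b, SameBlock π a b → u < a → a ≤ t → b ≤ t := by
      intro a b hab h h'
      by_contra hcon
      exact absurd (humax a ⟨hab.left_mem, h', b, not_le.1 hcon, hab⟩) (not_le.2 h)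
    have hK : SameBlock (relKreweras π) u t := by
      rw [sameBlock_relKreweras]
      refine ⟨huS, htS, fun a b hab => ?_⟩
      have := key a b hab
      have := key b a hab.symm
      have := key' a b hab
      have := key' b a hab.symm
      grind
    have hrv : r x v := r.trans hxt (r.trans (r.symm (h2 _ _ hK)) (h1 _ _ huv))
    exact absurd (htmax v ⟨huv.right_mem, hrv⟩) (not_le.2 htv)
  · refine r.trans hxt (h2 _ _ ?_)
    rw [Finset.not_nonempty_iff_eq_empty, Finset.filter_eq_empty_iff] at hD
    rw [sameBlock_relKreweras]
    refine ⟨htS, Finset.max'_mem _ _, fun a b hab => ?_⟩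
    have := Finset.le_max' S a hab.left_mem
    have := Finset.le_max' S b hab.right_mem
    have h3 := hD hab.left_mem
    have h4 := hD hab.right_mem
    simp only [not_and, not_exists] at h3 h4
    have h3 := fun h h' => h3 h b h' hab
    have h4 := fun h h' => h4 h a h' hab.symm
    grind

/-- A compatible partition which together with `π` connects the whole ground set is the Kreweras
complement of `π`. -/
theorem eq_relKreweras_of_connected {π σ : Finpartition S} (hσ : IsNonCrossing σ)
    (hc : Compatible π σ)
    (hconn : ∀ U : Set α, (∀ x y, SameBlock π x y → (x ∈ U ↔ y ∈ U)) →
      (∀ x y, SameBlock σ x y → (x ∈ U ↔ y ∈ U)) → ∀ x ∈ S, ∀ y ∈ S, x ∈ U → y ∈ U) :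
    σ = relKreweras π := by
  classical
  have hle : ∀ i j, SameBlock σ i j → SameBlock (relKreweras π) i j := fun i j h =>
    (sameBlock_relKreweras π i j).2 ⟨h.left_mem, h.right_mem, hc i j h⟩
  refine finpartition_ext_sameBlock fun i j => ⟨hle i j, fun hij => ?_⟩
  by_contra hnot
  -- If `σ` were strictly finer than the complement, some Kreweras block `B` would split into
  -- several blocks of `σ`. Take such a block `T` that avoids the minimum of `B`, with extremes `s`
  -- and `t`, and let `p` be the predecessor of `s` in `B`. The interval `(p, t]` will contradict
  -- connectedness.
  set B := S.filter (fun b => SameBlock (relKreweras π) i b) with hB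
  have hBi : i ∈ B := by simp [hB, hij.left_mem, SameBlock.refl]
  have hBj : j ∈ B := by simp [hB, hij.right_mem, hij]
  obtain ⟨m, hmB, hmin⟩ : ∃ m ∈ B, ∀ b ∈ B, m ≤ b :=
    ⟨B.min' ⟨i, hBi⟩, Finset.min'_mem _ _, fun b hb => Finset.min'_le _ _ hb⟩
  have hBB : ∀ {a b}, a ∈ B → b ∈ B → SameBlock (relKreweras π) a b := fun ha hb =>
    (Finset.mem_filter.1 ha).2.symm.trans (Finset.mem_filter.1 hb).2
  have hBK : ∀ {a b}, a ∈ B → SameBlock (relKreweras π) a b → b ∈ B := fun ha hab =>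
    Finset.mem_filter.2 ⟨hab.right_mem, (Finset.mem_filter.1 ha).2.trans hab⟩
  obtain ⟨l, hlB, hml⟩ : ∃ l ∈ B, ¬ SameBlock σ m l := by
    by_contra hcon
    push Not at hcon
    exact hnot ((hcon i hBi).symm.trans (hcon j hBj))
  set T := S.filter (fun b => SameBlock σ l b) with hT
  have hTl : l ∈ T := by
    have : l ∈ S := (hBB hlB hlB).left_mem
    simp [hT, this, SameBlock.refl]
  have hTB : ∀ {b}, b ∈ T → b ∈ B := fun hb => hBK hlB (hle _ _ (Finset.mem_filter.1 hb).2)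
  have hTσ : ∀ {a b}, a ∈ T → SameBlock σ a b → b ∈ T := fun ha hab =>
    Finset.mem_filter.2 ⟨hab.right_mem, (Finset.mem_filter.1 ha).2.trans hab⟩
  have hTT : ∀ {a b}, a ∈ T → b ∈ T → SameBlock σ a b := fun ha hb =>
    (Finset.mem_filter.1 ha).2.symm.trans (Finset.mem_filter.1 hb).2
  obtain ⟨s, hsT, hsmin⟩ : ∃ m ∈ T, ∀ b ∈ T, m ≤ b :=
    ⟨T.min' ⟨l, hTl⟩, Finset.min'_mem _ _, fun b hb => Finset.min'_le _ _ hb⟩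
  obtain ⟨t, htT, htmax⟩ : ∃ m ∈ T, ∀ b ∈ T, b ≤ m :=
    ⟨T.max' ⟨l, hTl⟩, Finset.max'_mem _ _, fun b hb => Finset.le_max' _ _ hb⟩
  have hms : m < s := by
    refine lt_of_le_of_ne (hmin s (hTB hsT)) ?_
    rintro rfl
    exact hml (hTT hsT hTl)
  obtain ⟨p, hpB, hps, hpmax⟩ : ∃ p ∈ B, p < s ∧ ∀ b ∈ B, b < s → b ≤ p := by
    have hne : (B.filter (· < s)).Nonempty := ⟨m, by simp [hmB, hms]⟩
    refine ⟨_, (Finset.mem_filter.1 (Finset.max'_mem _ hne)).1,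
      (Finset.mem_filter.1 (Finset.max'_mem _ hne)).2, fun b hb hbs => ?_⟩
    exact Finset.le_max' _ _ (Finset.mem_filter.2 ⟨hb, hbs⟩)
  have hst : s ≤ t := hsmin t htT
  have hpt : SameBlock (relKreweras π) p t := hBB hpB (hTB htT)
  have hstσ : SameBlock σ s t := hTT hsT htT
  -- A block of `σ` leaving `(p, t]` would cross `T` if it lies in `B`, since it then lies beyond
  -- `s`; otherwise it would lie in a Kreweras block crossing `B`.
  have hU : ∀ x y, SameBlock σ x y → p < x → x ≤ t → p < y ∧ y ≤ t := by
    intro x y hxy hpx hxt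
    by_cases hxB : x ∈ B
    · have hsx : s ≤ x := by
        by_contra h
        exact absurd (hpmax x hxB (not_le.1 h)) (not_le.2 hpx)
      by_cases hxT : x ∈ T
      · have hyT := hTσ hxT hxy
        exact ⟨hps.trans_le (hsmin y hyT), htmax y hyT⟩
      · by_contra hcon
        have hsx' : s < x := lt_of_le_of_ne hsx (by rintro rfl; exact hxT hsT)
        have hxt' : x < t := lt_of_le_of_ne hxt (by rintro rfl; exact hxT htT)
        have hy : y < s ∨ t < y := by grind
        rcases hy with hy | hy
        · exact hxT (hTσ htT (hσ y s x t hy hsx' hxt' hxy.symm hstσ |>.trans hstσ).symm)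
        · exact hxT (hTσ htT (hσ s x t y hsx' hxt' hy hstσ hxy))
    · have hxt' : x < t := lt_of_le_of_ne hxt (by rintro rfl; exact hxB (hTB htT))
      have hxyK := hle _ _ hxy
      by_contra hcon
      have hyp : y ≠ p := by
        rintro rfl
        exact hxB (hBK hpB hxyK.symm)
      have hy : y < p ∨ t < y := by grind
      have hnc := isNonCrossing_relKreweras π
      rcases hy with hy | hy
      · exact hxB (hBK hpB (hnc y p x t hy hpx hxt' hxyK.symm hpt).symm)
      · exact hxB (hBK hpB (hpt.trans (hnc p x t y hpx hxt' hy hpt hxyK)))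
  -- Saturation under `π` holds because `p` and `t` share a Kreweras block and so separate the same
  -- pairs.
  have hpU := hconn {x | p < x ∧ x ≤ t} (fun x y hxy => by
      have := compatible_relKreweras π p t hpt x y hxy
      simp only [Set.mem_ofPred_eq]
      grind) (fun x y hxy => ⟨fun h => hU x y hxy h.1 h.2, fun h => hU y x hxy.symm h.1 h.2⟩)
    t hpt.right_mem p hpt.left_mem ⟨hps.trans_le hst, le_rfl⟩
  exact lt_irrefl _ hpU.1

end Relative

/-! ### The join of a compatible pair -/

section Join

variable {α : Type*} [LinearOrder α] {S : Finset α}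

/-- The equivalence relation generated by the block relations of two partitions. -/
def joinSetoid (π σ : Finpartition S) : Setoid α :=
  Relation.EqvGen.setoid fun x y => SameBlock π x y ∨ SameBlock σ x y

theorem joinSetoid_of_left {π σ : Finpartition S} {x y : α} (h : SameBlock π x y) :
    joinSetoid π σ x y := Relation.EqvGen.rel _ _ (Or.inl h)

theorem joinSetoid_of_right {π σ : Finpartition S} {x y : α} (h : SameBlock σ x y) :
    joinSetoid π σ x y := Relation.EqvGen.rel _ _ (Or.inr h)

theorem iff_of_joinSetoid {π σ : Finpartition S} {U : α → Prop}
    (h1 : ∀ x y, SameBlock π x y → (U x ↔ U y)) (h2 : ∀ x y, SameBlock σ x y → (U x ↔ U y))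
    {x y : α} (h : joinSetoid π σ x y) : U x ↔ U y := by
  induction h with
  | rel x y h => exact h.elim (h1 x y) (h2 x y)
  | refl x => rfl
  | symm x y _ ih => exact ih.symm
  | trans x y z _ _ ih ih' => exact ih.trans ih'

/-- Two points of one block separating a pair of another block differently would be a crossing.
Membership in different blocks makes the relevant points distinct, so the half-open convention in
the separation condition plays no role. -/
theorem IsNonCrossing.separation {π : Finpartition S} (hπ : IsNonCrossing π) {x y u v : α}
    (hxy : SameBlock π x y) (huv : SameBlock π u v) (h : ¬ SameBlock π x u) :
    (x < u ↔ x < v) ↔ (y < u ↔ y < v) := by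
  have hxv : ¬ SameBlock π x v := fun h' => h (h'.trans huv.symm)
  have hyu : ¬ SameBlock π y u := fun h' => h (hxy.trans h')
  have hyv : ¬ SameBlock π y v := fun h' => hxv (hxy.trans h')
  have n1 : x ≠ u := by rintro rfl; exact h (huv.trans huv.symm)
  have n2 : x ≠ v := by rintro rfl; exact h huv.symm
  have n3 : y ≠ u := by rintro rfl; exact h hxy
  have n4 : y ≠ v := by rintro rfl; exact hxv hxy
  have key : ∀ x y u v, SameBlock π x y → SameBlock π u v → ¬ SameBlock π x u →
      x < u → u < y → y < v → False := fun x y u v hxy huv h h1 h2 h3 =>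
    h (hxy.trans (hπ x u y v h1 h2 h3 hxy huv))
  have := key x y u v hxy huv h
  have := key x y v u hxy huv.symm hxv
  have := key y x u v hxy.symm huv hyu
  have := key y x v u hxy.symm huv.symm hyv
  have := key u v x y huv hxy fun h' => h h'.symm
  have := key u v y x huv hxy.symm fun h' => hyu h'.symm
  have := key v u x y huv.symm hxy fun h' => hxv h'.symm
  have := key v u y x huv.symm hxy.symm fun h' => hyv h'.symm
  clear key hxy huv h hxv hyu hyv hπ
  rcases lt_or_gt_of_ne n1 with h1 | h1 <;> rcases lt_or_gt_of_ne n2 with h2 | h2 <;>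
    rcases lt_or_gt_of_ne n3 with h3 | h3 <;> rcases lt_or_gt_of_ne n4 with h4 | h4 <;>
    simp only [h1, h2, h3, h4, h1.not_gt, h2.not_gt, h3.not_gt, h4.not_gt] <;> grind

/-- Induction along the chain from `x` to `y`, whose links lie in blocks of `π` or `σ`. A link and
the pair `u`, `v` from the same partition do not cross; from different partitions they are
controlled by compatibility, which is symmetric here because the points are distinct. -/
theorem separation_of_joinSetoid {π σ : Finpartition S} (hπ : IsNonCrossing π)
    (hσ : IsNonCrossing σ) (hc : Compatible π σ) {u v : α}
    (huv : SameBlock π u v ∨ SameBlock σ u v) {x y : α} (hxy : joinSetoid π σ x y)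
    (h : ¬ joinSetoid π σ x u) : (x < u ↔ x < v) ↔ (y < u ↔ y < v) := by
  have hr : joinSetoid π σ u v := Relation.EqvGen.rel _ _ huv
  induction hxy with
  | rel x y hxy =>
    have hr' : joinSetoid π σ x y := Relation.EqvGen.rel _ _ hxy
    have n1 : x ≠ u := by rintro rfl; exact h ((joinSetoid π σ).refl _)
    have n2 : x ≠ v := by rintro rfl; exact h ((joinSetoid π σ).symm hr)
    have n3 : y ≠ u := by rintro rfl; exact h hr'
    have n4 : y ≠ v := by
      rintro rfl; exact h ((joinSetoid π σ).trans hr' ((joinSetoid π σ).symm hr))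
    rcases hxy with hxy | hxy <;> rcases huv with huv | huv
    · exact hπ.separation hxy huv fun h' => h (joinSetoid_of_left h')
    · have := hc u v huv x y hxy
      grind
    · exact hc x y hxy u v huv
    · exact hσ.separation hxy huv fun h' => h (joinSetoid_of_right h')
  | refl x => rfl
  | symm x y hxy ih =>
    exact (ih fun h' => h ((joinSetoid π σ).trans ((joinSetoid π σ).symm hxy) h')).symm
  | trans x y z hxy _ ih ih' =>
    exact (ih h).trans
      (ih' fun h' => h ((joinSetoid π σ).trans hxy h'))

/-- The join of two compatible non-crossing partitions. -/
noncomputable def joinPartition (π σ : Finpartition S) : Finpartition S :=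
  tracePartition (joinSetoid π σ) S

theorem sameBlock_joinPartition (π σ : Finpartition S) (x y : α) :
    SameBlock (joinPartition π σ) x y ↔ x ∈ S ∧ y ∈ S ∧ joinSetoid π σ x y :=
  sameBlock_tracePartition _ _ _ _

theorem isNonCrossing_joinPartition {π σ : Finpartition S} (hπ : IsNonCrossing π)
    (hσ : IsNonCrossing σ) (hc : Compatible π σ) : IsNonCrossing (joinPartition π σ) := by
  intro p₁ q₁ p₂ q₂ h1 h2 h3 hp hq
  rw [sameBlock_joinPartition] at hp hq ⊢
  refine ⟨hp.2.1, hq.1, ?_⟩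
  set r := joinSetoid π σ with hr
  by_contra hcon
  have hnot : ¬ r p₁ q₁ := fun h => hcon (r.trans (r.symm hp.2.2) h)
  -- A second induction, along the chain joining `q₁` to `q₂`, extends the separation property from
  -- generating pairs to all pairs in the class of `q₁`.
  have main : ∀ u v, r u v → r u q₁ → ((p₁ < u ↔ p₁ < v) ↔ (p₂ < u ↔ p₂ < v)) := by
    intro u v huv
    induction huv with
    | rel u v huv =>
      intro h
      exact separation_of_joinSetoid hπ hσ hc huv hp.2.2 fun h' => hnot (r.trans h' h)
    | refl u => simp
    | symm u v huv ih =>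
      intro h
      have := ih (r.trans huv h)
      grind
    | trans u v w huv _ ih ih' =>
      intro h
      have := ih h
      have := ih' (r.trans (r.symm huv) h)
      grind
  have := main q₁ q₂ hq.2.2 (r.refl _)
  grind

end Join

/-! ## Factorization of compatible pairs over their join -/

section Factorization

variable {α : Type*} [LinearOrder α] {S : Finset α}

theorem isNonCrossing_bind {ρ : Finpartition S} (hρ : IsNonCrossing ρ)
    {Q : ∀ V ∈ ρ.parts, Finpartition V} (hQ : ∀ V hV, IsNonCrossing (Q V hV)) :
    IsNonCrossing (ρ.bind Q) := by
  intro p₁ q₁ p₂ q₂ h1 h2 h3 hp hq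
  rw [sameBlock_bind] at hp hq ⊢
  obtain ⟨V, hV, hp⟩ := hp
  obtain ⟨W, hW, hq⟩ := hq
  obtain ⟨Z, hZ, hpZ, hqZ⟩ := hρ p₁ q₁ p₂ q₂ h1 h2 h3
    ⟨V, hV, hp.left_mem, hp.right_mem⟩ ⟨W, hW, hq.left_mem, hq.right_mem⟩
  obtain rfl := ρ.eq_of_mem_parts hV hZ hp.right_mem hpZ
  obtain rfl := ρ.eq_of_mem_parts hW hV hq.left_mem hqZ
  exact ⟨W, hW, hQ W hW p₁ q₁ p₂ q₂ h1 h2 h3 hp hq⟩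

theorem compatible_bind {ρ : Finpartition S} (hρ : IsNonCrossing ρ)
    {Q Q' : ∀ V ∈ ρ.parts, Finpartition V} (hQ : ∀ V hV, Compatible (Q V hV) (Q' V hV)) :
    Compatible (ρ.bind Q) (ρ.bind Q') := by
  intro i j hij x y hxy
  rw [sameBlock_bind] at hij hxy
  obtain ⟨V, hV, hij⟩ := hij
  obtain ⟨W, hW, hxy⟩ := hxy
  by_cases hVW : V = W
  · subst hVW
    exact hQ V hV i j hij x y hxy
  · refine hρ.separation ⟨V, hV, hij.left_mem, hij.right_mem⟩
      ⟨W, hW, hxy.left_mem, hxy.right_mem⟩ ?_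
    rintro ⟨Z, hZ, h1, h2⟩
    exact hVW ((ρ.eq_of_mem_parts hV hZ hij.left_mem h1).trans
      (ρ.eq_of_mem_parts hW hZ hxy.left_mem h2).symm)

/-- Two families of partitions of the blocks of `ρ` and `ρ'` which, together with their Kreweras
complements, glue to the same pair: `ρ` refines `ρ'`. -/
theorem sameBlock_of_bind_eq {ρ ρ' : Finpartition S} {Q : ∀ V ∈ ρ.parts, Finpartition V}
    {Q' : ∀ V ∈ ρ'.parts, Finpartition V} (hQ : ∀ V hV, IsNonCrossing (Q V hV))
    (h1 : ρ.bind Q = ρ'.bind Q')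
    (h2 : ρ.bind (fun V hV => relKreweras (Q V hV)) =
      ρ'.bind (fun V hV => relKreweras (Q' V hV))) {x y : α} (h : SameBlock ρ x y) :
    SameBlock ρ' x y := by
  have key : ∀ (Q'' : ∀ V ∈ ρ'.parts, Finpartition V) x y, SameBlock (ρ'.bind Q'') x y →
      blockSetoid ρ' x y := by
    intro Q'' x y hxy
    rw [blockSetoid_iff _ hxy.left_mem]
    obtain ⟨V, hV, hxy⟩ := (sameBlock_bind _ _ _ _).1 hxy
    exact ⟨V, hV, hxy.left_mem, hxy.right_mem⟩
  rw [← blockSetoid_iff _ h.left_mem]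
  obtain ⟨V, hV, hx, hy⟩ := h
  refine connected_relKreweras (hQ V hV) (blockSetoid ρ') (fun x y hxy => key Q' x y ?_)
    (fun x y hxy => key (fun V hV => relKreweras (Q' V hV)) x y ?_) hx hy
  · rw [← h1, sameBlock_bind]
    exact ⟨V, hV, hxy⟩
  · rw [← h2, sameBlock_bind]
    exact ⟨V, hV, hxy⟩

/-- The pairs of compatible non-crossing partitions of `S`. -/
abbrev CompatiblePair (S : Finset α) : Type _ :=
  {p : NCOn S × NCOn S // Compatible p.1.1 p.2.1}

noncomputable instance instFintypeCompatiblePair (S : Finset α) : Fintype (CompatiblePair S) :=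
  Fintype.ofFinite _

/-- Summing over all non-crossing partitions `ρ` and, for each block of `ρ`, over a non-crossing
partition and its Kreweras complement amounts to summing over the compatible pairs. -/
theorem sum_prod_relKreweras {R : Type*} [CommRing R] (f g : Finset α → R) :
    ∑ ρ : NCOn S, ∏ V ∈ ρ.1.parts, ∑ π : NCOn V,
      (∏ W ∈ π.1.parts, f W) * ∏ W ∈ (relKreweras π.1).parts, g W =
    ∑ p : CompatiblePair S,
      (∏ W ∈ p.1.1.1.parts, f W) * ∏ W ∈ p.1.2.1.parts, g W := by
  classical
  -- A product of sums becomes a sum over choice functions, so the left side is indexed by `ρ` with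
  -- one partition of each block.
  simp only [Finset.prod_sum, Finset.sum_sigma']
  refine Finset.sum_bij (fun z _ =>
    ⟨(⟨z.1.1.bind fun V hV => (z.2 V hV).1, isNonCrossing_bind z.1.2 fun V hV => (z.2 V hV).2⟩,
      ⟨z.1.1.bind fun V hV => relKreweras (z.2 V hV).1,
        isNonCrossing_bind z.1.2 fun V hV => isNonCrossing_relKreweras _⟩),
      compatible_bind z.1.2 fun V hV => compatible_relKreweras _⟩)
    (fun _ _ => Finset.mem_univ _) ?_ ?_ ?_
  · rintro ⟨⟨ρ, hρ⟩, Q⟩ _ ⟨⟨ρ', hρ'⟩, Q'⟩ _ h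
    simp only [Subtype.mk.injEq, Prod.mk.injEq] at h
    obtain ⟨h1, h2⟩ := h
    obtain rfl : ρ = ρ' := finpartition_ext_sameBlock fun x y =>
      ⟨sameBlock_of_bind_eq (fun V hV => (Q V hV).2) h1 h2,
        sameBlock_of_bind_eq (fun V hV => (Q' V hV).2) h1.symm h2.symm⟩
    congr 1
    funext V hV
    refine Subtype.ext (finpartition_ext_sameBlock fun x y => ?_)
    rw [sameBlock_of_sameBlock_bind ρ (fun V hV => (Q V hV).1) hV, h1,
      sameBlock_of_sameBlock_bind ρ (fun V hV => (Q' V hV).1) hV]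
  · rintro ⟨⟨⟨π, hπ⟩, ⟨σ, hσ⟩⟩, hc⟩ _
    have htr : ∀ (τ : Finpartition S) (V : Finset α) (hVS : V ⊆ S) (x y : α),
        SameBlock (tracePartition (blockSetoid τ) V) x y ↔ x ∈ V ∧ y ∈ V ∧ SameBlock τ x y := by
      intro τ V hVS x y
      rw [sameBlock_tracePartition]
      refine and_congr_right fun hx => and_congr_right fun hy => blockSetoid_iff _ (hVS hx)
    have hncV : ∀ (τ : Finpartition S) (V : Finset α) (hVS : V ⊆ S), IsNonCrossing τ →
        IsNonCrossing (tracePartition (blockSetoid τ) V) := by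
      intro τ V hVS hτ p₁ q₁ p₂ q₂ h1 h2 h3 hp hq
      rw [htr τ V hVS] at hp hq ⊢
      exact ⟨hp.2.1, hq.1, hτ p₁ q₁ p₂ q₂ h1 h2 h3 hp.2.2 hq.2.2⟩
    set ρ := joinPartition π σ with hρ
    have hbind : ∀ τ : Finpartition S, (∀ x y, SameBlock τ x y → SameBlock ρ x y) →
        (ρ.bind fun V hV => tracePartition (blockSetoid τ) V) = τ := by
      intro τ hτ
      refine finpartition_ext_sameBlock fun x y => ?_
      rw [sameBlock_bind]
      constructor
      · rintro ⟨V, hV, h⟩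
        exact ((htr τ V (ρ.le hV) x y).1 h).2.2
      · intro h
        obtain ⟨V, hV, hx, hy⟩ := hτ x y h
        exact ⟨V, hV, (htr τ V (ρ.le hV) x y).2 ⟨hx, hy, h⟩⟩
    -- Surjectivity hinges on this: the traces of `π` and `σ` on a block of the join are compatible
    -- and connect that block, so one is the Kreweras complement of the other.
    have hK : ∀ V ∈ ρ.parts,
        relKreweras (tracePartition (blockSetoid π) V) = tracePartition (blockSetoid σ) V := by
      intro V hV
      have hVS := ρ.le hV
      symm
      apply eq_relKreweras_of_connected (hncV σ V hVS hσ)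
      · intro i j hij x y hxy
        rw [htr _ V hVS] at hij hxy
        exact hc i j hij.2.2 x y hxy.2.2
      · intro U hU1 hU2 x hx y hy hxU
        have hblock : ∀ a b, joinSetoid π σ a b → a ∈ S → b ∈ S → (a ∈ V ↔ b ∈ V) := by
          intro a b hab ha hb
          have : SameBlock ρ a b := (sameBlock_joinPartition _ _ _ _).2 ⟨ha, hb, hab⟩
          exact (blockSetoid_iff ρ ha).2 this V hV
        have hxy : joinSetoid π σ x y :=
          ((sameBlock_joinPartition π σ x y).1 ⟨V, hV, hx, hy⟩).2.2
        -- A set saturated for the traces becomes saturated for `π` and `σ` themselves once cut down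
        -- to `V`.
        have := iff_of_joinSetoid (U := fun a => a ∈ V ∧ a ∈ U) (fun a b hab => ?_)
          (fun a b hab => ?_) hxy
        · exact (this.1 ⟨hx, hxU⟩).2
        · have h := hblock a b (joinSetoid_of_left hab) hab.left_mem hab.right_mem
          have h' := fun ha hb => hU1 a b ((htr π V hVS a b).2 ⟨ha, hb, hab⟩)
          tauto
        · have h := hblock a b (joinSetoid_of_right hab) hab.left_mem hab.right_mem
          have h' := fun ha hb => hU2 a b ((htr σ V hVS a b).2 ⟨ha, hb, hab⟩)
          tauto
    refine ⟨⟨⟨ρ, isNonCrossing_joinPartition hπ hσ hc⟩, fun V hV =>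
      ⟨tracePartition (blockSetoid π) V, hncV π V (ρ.le hV) hπ⟩⟩, by simp, ?_⟩
    have hb1 := hbind π fun x y h =>
      (sameBlock_joinPartition _ _ _ _).2 ⟨h.left_mem, h.right_mem, joinSetoid_of_left h⟩
    have hb2 := hbind σ fun x y h =>
      (sameBlock_joinPartition _ _ _ _).2 ⟨h.left_mem, h.right_mem, joinSetoid_of_right h⟩
    refine Subtype.ext (Prod.ext (Subtype.ext hb1) (Subtype.ext ?_))
    refine Eq.trans ?_ hb2
    show (ρ.bind fun V hV => relKreweras (tracePartition (blockSetoid π) V)) = _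
    congr 1
    funext V hV
    exact hK V hV
  · rintro ⟨⟨ρ, hρ⟩, Q⟩ _
    simp only [prod_bind_parts, Finset.prod_mul_distrib]

end Factorization

/-! ## Transport along order embeddings -/

section Transport

variable {α β : Type*} [LinearOrder α] [LinearOrder β] {T : Finset β}

/-- The image of a partition under an order embedding. -/
def mapPartition (e : β ↪o α) (π : Finpartition T) : Finpartition (T.map e.toEmbedding) :=
  Finpartition.ofExistsUnique (π.parts.map (Finset.mapEmbedding e.toEmbedding).toEmbedding)
    (by
      intro V hV
      obtain ⟨W, hW, rfl⟩ := Finset.mem_map.1 hV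
      exact Finset.map_subset_map.2 (π.le hW))
    (by
      intro x hx
      obtain ⟨y, hy, rfl⟩ := Finset.mem_map.1 hx
      obtain ⟨W, hW, hyW⟩ := π.exists_mem hy
      refine ⟨W.map e.toEmbedding, ⟨Finset.mem_map.2 ⟨W, hW, rfl⟩,
        (Finset.mem_map' _).2 hyW⟩, ?_⟩
      rintro _ ⟨hV, hyV⟩
      obtain ⟨V, hVπ, rfl⟩ := Finset.mem_map.1 hV
      have hyV' : y ∈ V := (Finset.mem_map' e.toEmbedding).1 hyV
      rw [π.eq_of_mem_parts hVπ hW hyV' hyW]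
      rfl)
    (by
      intro h
      obtain ⟨V, hV, h⟩ := Finset.mem_map.1 h
      exact π.ne_empty hV (Finset.map_eq_empty.1 h))

theorem mapPartition_parts (e : β ↪o α) (π : Finpartition T) :
    (mapPartition e π).parts =
      π.parts.map (Finset.mapEmbedding e.toEmbedding).toEmbedding := rfl

theorem prod_mapPartition_parts {M : Type*} [CommMonoid M] (e : β ↪o α) (π : Finpartition T)
    (f : Finset α → M) :
    ∏ W ∈ (mapPartition e π).parts, f W = ∏ W ∈ π.parts, f (W.map e.toEmbedding) := by
  rw [mapPartition_parts, Finset.prod_map]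
  rfl

theorem sameBlock_mapPartition_apply (e : β ↪o α) (π : Finpartition T) (i j : β) :
    SameBlock (mapPartition e π) (e i) (e j) ↔ SameBlock π i j := by
  rw [SameBlock, mapPartition_parts]
  constructor
  · rintro ⟨_, hV, h1, h2⟩
    obtain ⟨V, hVπ, rfl⟩ := Finset.mem_map.1 hV
    exact ⟨V, hVπ, (Finset.mem_map' e.toEmbedding).1 h1, (Finset.mem_map' e.toEmbedding).1 h2⟩
  · rintro ⟨V, hV, h1, h2⟩
    exact ⟨V.map e.toEmbedding, Finset.mem_map.2 ⟨V, hV, rfl⟩,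
      (Finset.mem_map' e.toEmbedding).2 h1, (Finset.mem_map' e.toEmbedding).2 h2⟩

theorem SameBlock.exists_of_map {e : β ↪o α} {π : Finpartition (T.map e.toEmbedding)} {x y : α}
    (h : SameBlock π x y) : ∃ i ∈ T, ∃ j ∈ T, e i = x ∧ e j = y := by
  obtain ⟨i, hi, rfl⟩ := Finset.mem_map.1 h.left_mem
  obtain ⟨j, hj, rfl⟩ := Finset.mem_map.1 h.right_mem
  exact ⟨i, hi, j, hj, rfl, rfl⟩

theorem mapPartition_eq_iff {e : β ↪o α} {π : Finpartition T}
    {σ : Finpartition (T.map e.toEmbedding)} :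
    mapPartition e π = σ ↔ ∀ i j, SameBlock σ (e i) (e j) ↔ SameBlock π i j := by
  constructor
  · rintro rfl i j
    exact sameBlock_mapPartition_apply e π i j
  · intro h
    refine finpartition_ext_sameBlock fun x y => ⟨fun hxy => ?_, fun hxy => ?_⟩
    · obtain ⟨i, _, j, _, rfl, rfl⟩ := hxy.exists_of_map
      rwa [h, ← sameBlock_mapPartition_apply e]
    · obtain ⟨i, _, j, _, rfl, rfl⟩ := hxy.exists_of_map
      rwa [sameBlock_mapPartition_apply, ← h]

theorem isNonCrossing_mapPartition_iff (e : β ↪o α) (π : Finpartition T) :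
    IsNonCrossing (mapPartition e π) ↔ IsNonCrossing π := by
  constructor
  · intro h p₁ q₁ p₂ q₂ h1 h2 h3 hp hq
    rw [← sameBlock_mapPartition_apply e] at hp hq ⊢
    exact h _ _ _ _ (e.lt_iff_lt.2 h1) (e.lt_iff_lt.2 h2) (e.lt_iff_lt.2 h3) hp hq
  · intro h p₁ q₁ p₂ q₂ h1 h2 h3 hp hq
    obtain ⟨i, _, j, _, rfl, rfl⟩ := hp.exists_of_map
    obtain ⟨k, _, l, _, rfl, rfl⟩ := hq.exists_of_map
    rw [sameBlock_mapPartition_apply] at hp hq ⊢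
    exact h _ _ _ _ (e.lt_iff_lt.1 h1) (e.lt_iff_lt.1 h2) (e.lt_iff_lt.1 h3) hp hq

theorem relKreweras_mapPartition (e : β ↪o α) (π : Finpartition T) :
    relKreweras (mapPartition e π) = mapPartition e (relKreweras π) := by
  symm
  rw [mapPartition_eq_iff]
  intro i j
  have hmem : ∀ i, e i ∈ T.map e.toEmbedding ↔ i ∈ T := fun i => Finset.mem_map' e.toEmbedding
  rw [sameBlock_relKreweras, sameBlock_relKreweras, hmem, hmem]
  refine and_congr_right fun _ => and_congr_right fun _ => ⟨fun h x y hxy => ?_,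
    fun h x y hxy => ?_⟩
  · have := h (e x) (e y) ((sameBlock_mapPartition_apply e π x y).2 hxy)
    simpa only [e.lt_iff_lt] using this
  · obtain ⟨k, _, l, _, rfl, rfl⟩ := hxy.exists_of_map
    simpa only [e.lt_iff_lt] using h k l ((sameBlock_mapPartition_apply e π k l).1 hxy)

theorem bijective_mapPartition (e : β ↪o α) (T : Finset β) : Function.Bijective
    (fun π : NCOn T => (⟨mapPartition e π.1, (isNonCrossing_mapPartition_iff e π.1).2 π.2⟩ :
      NCOn (T.map e.toEmbedding))) := by
  constructor
  · intro π σ h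
    refine Subtype.ext (finpartition_ext_sameBlock fun i j => ?_)
    have h' : mapPartition e π.1 = mapPartition e σ.1 := congrArg Subtype.val h
    rw [← sameBlock_mapPartition_apply e, ← sameBlock_mapPartition_apply e σ.1, h']
  · intro σ
    have h : mapPartition e (tracePartition ((blockSetoid σ.1).comap e) T) = σ.1 := by
      rw [mapPartition_eq_iff]
      intro i j
      have hmem : ∀ i, e i ∈ T.map e.toEmbedding ↔ i ∈ T := fun i =>
        Finset.mem_map' e.toEmbedding
      rw [sameBlock_tracePartition]
      constructor
      · intro h
        exact ⟨(hmem _).1 h.left_mem, (hmem _).1 h.right_mem,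
          (blockSetoid_iff _ h.left_mem).2 h⟩
      · rintro ⟨hi, hj, h⟩
        exact (blockSetoid_iff _ ((hmem _).2 hi)).1 h
    exact ⟨⟨_, (isNonCrossing_mapPartition_iff e _).1 (h.symm ▸ σ.2)⟩, Subtype.ext h⟩

theorem kreweras_eq_relKreweras {n : ℕ} (π : NC n) : (kreweras π).1 = relKreweras π.1 :=
  finpartition_ext_sameBlock fun i j => by
    rw [sameBlock_kreweras, sameBlock_relKreweras]
    simp

end Transport

/-! ## Families of functions of several arguments, evaluated along subsets -/

section OnSubset

variable {α β X R : Type*} [LinearOrder α] [LinearOrder β]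

/-- The value of the member of a family `h` of functions of `1, 2, …` arguments at the
restriction of `x` to `W`. -/
def onSubset (h : (m : ℕ) → (Fin m → X) → R) (x : α → X) (W : Finset α) : R :=
  h W.card fun j => x (W.orderEmbOfFin rfl j)

theorem onSubset_eq (h : (m : ℕ) → (Fin m → X) → R) (x : α → X) {W : Finset α} {m : ℕ}
    (f : Fin m ↪o α) (hf : Finset.univ.map f.toEmbedding = W) :
    onSubset h x W = h m (fun j => x (f j)) := by
  obtain rfl : m = W.card := by rw [← hf]; simp
  rw [Finset.orderEmbOfFin_unique' (s := W) rfl (f := f) fun j => by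
    exact hf.subset (Finset.mem_map_of_mem _ (Finset.mem_univ j))]
  rfl

theorem onSubset_map (h : (m : ℕ) → (Fin m → X) → R) (x : α → X) (e : β ↪o α) (W : Finset β) :
    onSubset h x (W.map e.toEmbedding) = onSubset h (x ∘ e) W := by
  refine onSubset_eq h x ((W.orderEmbOfFin rfl).trans e) ?_
  conv_rhs => rw [← Finset.map_orderEmbOfFin_univ W rfl]
  rw [Finset.map_map]
  rfl

theorem onSubset_univ (h : (m : ℕ) → (Fin m → X) → R) {n : ℕ} (x : Fin n → X) :
    onSubset h x Finset.univ = h n x :=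
  onSubset_eq h x (RelEmbedding.refl (· ≤ ·)) (by ext; simp)

variable [CommRing R]

/-- The sum over the non-crossing partitions of the products over their blocks. -/
noncomputable def sumNC (h : (m : ℕ) → (Fin m → X) → R) (n : ℕ) (x : Fin n → X) : R :=
  ∑ π : NC n, ∏ V ∈ π.1.parts, onSubset h x V

/-- The boxed convolution of two families. -/
noncomputable def boxNC (h h' : (m : ℕ) → (Fin m → X) → R) (n : ℕ) (x : Fin n → X) : R :=
  ∑ π : NC n, (∏ V ∈ π.1.parts, onSubset h x V) * ∏ V ∈ (kreweras π).1.parts, onSubset h' x V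

/-- Together with `onSubset_boxNC`, this allows partitions of a block to remain partitions of a
subset, without renumbering its elements. -/
theorem onSubset_sumNC (h : (m : ℕ) → (Fin m → X) → R) (x : α → X) (S : Finset α) :
    onSubset (sumNC h) x S = ∑ π : NCOn S, ∏ V ∈ π.1.parts, onSubset h x V := by
  obtain ⟨m, f, rfl⟩ : ∃ m, ∃ f : Fin m ↪o α, Finset.univ.map f.toEmbedding = S :=
    ⟨_, _, Finset.map_orderEmbOfFin_univ S rfl⟩
  rw [onSubset_eq _ _ f rfl, ← (bijective_mapPartition f _).sum_comp]
  simp only [prod_mapPartition_parts, onSubset_map]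
  rfl

theorem onSubset_boxNC (h h' : (m : ℕ) → (Fin m → X) → R) (x : α → X) (S : Finset α) :
    onSubset (boxNC h h') x S = ∑ π : NCOn S, (∏ V ∈ π.1.parts, onSubset h x V) *
      ∏ V ∈ (relKreweras π.1).parts, onSubset h' x V := by
  obtain ⟨m, f, rfl⟩ : ∃ m, ∃ f : Fin m ↪o α, Finset.univ.map f.toEmbedding = S :=
    ⟨_, _, Finset.map_orderEmbOfFin_univ S rfl⟩
  rw [onSubset_eq _ _ f rfl, ← (bijective_mapPartition f _).sum_comp]
  simp only [relKreweras_mapPartition, prod_mapPartition_parts, onSubset_map, boxNC,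
    kreweras_eq_relKreweras]
  rfl

/-- The block sums of a boxed convolution are sums over compatible pairs. -/
theorem sumNC_boxNC (h h' : (m : ℕ) → (Fin m → X) → R) (n : ℕ) (x : Fin n → X) :
    sumNC (boxNC h h') n x = ∑ p : CompatiblePair (Finset.univ : Finset (Fin n)),
      (∏ V ∈ p.1.1.1.parts, onSubset h x V) * ∏ V ∈ p.1.2.1.parts, onSubset h' x V := by
  rw [← sum_prod_relKreweras]
  simp only [sumNC, onSubset_boxNC]

theorem parts_top_univ {n : ℕ} (hn : 1 ≤ n) :
    (⊤ : Finpartition (Finset.univ : Finset (Fin n))).parts = {Finset.univ} := by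
  have hne : (Finset.univ : Finset (Fin n)) ≠ ⊥ := by
    have : Nonempty (Fin n) := ⟨⟨0, hn⟩⟩
    exact Finset.univ_nonempty.ne_empty
  obtain ⟨V, hV⟩ := Finpartition.parts_nonempty
    (⊤ : Finpartition (Finset.univ : Finset (Fin n))) hne
  apply Finset.Subset.antisymm (Finpartition.parts_top_subset _)
  rw [Finset.singleton_subset_iff]
  exact Finset.mem_singleton.1 (Finpartition.parts_top_subset _ hV) ▸ hV

theorem sumNC_eq_add (h : (m : ℕ) → (Fin m → X) → R) {n : ℕ} (hn : 1 ≤ n) (x : Fin n → X) :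
    sumNC h n x = h n x + ∑ π ∈ Finset.univ.erase (⟨⊤, isNonCrossing_top n⟩ : NC n),
      ∏ V ∈ π.1.parts, onSubset h x V := by
  rw [sumNC, ← Finset.add_sum_erase _ _ (Finset.mem_univ (⟨⊤, isNonCrossing_top n⟩ : NC n)),
    parts_top_univ hn, Finset.prod_singleton, onSubset_univ]

/-- A family is determined by its block sums. -/
theorem eq_of_sumNC_eq {h h' : (m : ℕ) → (Fin m → X) → R}
    (hh : ∀ n, 1 ≤ n → ∀ x, sumNC h n x = sumNC h' n x) :
    ∀ n, 1 ≤ n → ∀ x, h n x = h' n x := by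
  intro n
  induction n using Nat.strong_induction_on with
  | _ n ih =>
    intro hn x
    have key := hh n hn x
    rw [sumNC_eq_add h hn, sumNC_eq_add h' hn] at key
    refine add_right_cancel (key.trans ?_)
    congr 1
    refine Finset.sum_congr rfl fun π hπ => Finset.prod_congr rfl fun V hV => ?_
    have hne : π.1 ≠ ⊤ := fun h => Finset.ne_of_mem_erase hπ (Subtype.ext h)
    exact (ih _ (card_lt_of_mem_parts_of_ne_top hne hV)
      (Finset.card_pos.2 (π.1.nonempty_of_mem_parts hV)) _).symm

end OnSubset

/-! ## Partitions of the doubled set -/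

section Doubled

variable {n : ℕ}

theorem doubled_lt_iff (i j : Fin n) (c d : Fin 2) :
    (toLex (i, c) : Doubled n) < toLex (j, d) ↔ i < j ∨ i = j ∧ c < d :=
  Prod.Lex.toLex_lt_toLex

theorem isNonCrossing_unionPartition {π σ : Finpartition (Finset.univ : Finset (Fin n))}
    (hπ : IsNonCrossing π) (hσ : IsNonCrossing σ) (hc : Compatible π σ) :
    IsNonCrossing (unionPartition π σ) := by
  intro p₁ q₁ p₂ q₂ h1 h2 h3 hp hq
  obtain ⟨⟨p₁, c₁⟩, rfl⟩ := toLex.surjective p₁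
  obtain ⟨⟨q₁, d₁⟩, rfl⟩ := toLex.surjective q₁
  obtain ⟨⟨p₂, c₂⟩, rfl⟩ := toLex.surjective p₂
  obtain ⟨⟨q₂, d₂⟩, rfl⟩ := toLex.surjective q₂
  rw [sameBlock_unionPartition] at hp hq ⊢
  rw [doubled_lt_iff] at h1 h2 h3
  rcases hp with ⟨rfl, rfl, hp⟩ | ⟨rfl, rfl, hp⟩ <;>
    rcases hq with ⟨rfl, rfl, hq⟩ | ⟨rfl, rfl, hq⟩
  · simp only [lt_irrefl, and_false, or_false] at h1 h2 h3
    exact Or.inl ⟨rfl, rfl, hπ _ _ _ _ h1 h2 h3 hp hq⟩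
  · exfalso
    have := hc _ _ hq _ _ hp
    simp at h1 h2 h3
    grind
  · exfalso
    have := hc _ _ hp _ _ hq
    simp at h1 h2 h3
    grind
  · simp only [lt_irrefl, and_false, or_false] at h1 h2 h3
    exact Or.inr ⟨rfl, rfl, hσ _ _ _ _ h1 h2 h3 hp hq⟩

/-- Maximality puts `σ` below the Kreweras complement, whose blocks separate the pairs of `π`
consistently by their explicit description. -/
theorem compatible_of_isNonCrossing_unionPartition (π σ : NC n)
    (h : IsNonCrossing (unionPartition π.1 σ.1)) : Compatible π.1 σ.1 := by
  intro i j hij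
  obtain ⟨V, hV, hi, hj⟩ := hij
  obtain ⟨W, hW, hVW⟩ := (kreweras_isGreatest π).2 h hV
  exact (sameBlock_kreweras π i j).1 ⟨W, hW, hVW hi, hVW hj⟩

/-- The order embedding of one of the two copies of `{1, …, n}` into the doubled set. -/
def inCopyEmb (c : Fin 2) : Fin n ↪o Doubled n :=
  OrderEmbedding.ofStrictMono (fun i => toLex (i, c)) fun i j h =>
    (doubled_lt_iff i j c c).2 (Or.inl h)

theorem inCopyEmb_toEmbedding (c : Fin 2) :
    (inCopyEmb c : Fin n ↪o Doubled n).toEmbedding = inCopy c := rfl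

theorem prod_unionPartition_parts {M : Type*} [CommMonoid M]
    (π σ : Finpartition (Finset.univ : Finset (Fin n))) (f : Finset (Doubled n) → M) :
    ∏ W ∈ (unionPartition π σ).parts, f W =
      (∏ V ∈ π.parts, f (V.map (inCopy 0))) * ∏ V ∈ σ.parts, f (V.map (inCopy 1)) := by
  have hparts : (unionPartition π σ).parts =
      π.parts.image (fun V => V.map (inCopy 0)) ∪ σ.parts.image (fun V => V.map (inCopy 1)) := rfl
  rw [hparts, Finset.prod_union, Finset.prod_image, Finset.prod_image]
  · exact fun V _ W _ h => Finset.map_injective _ h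
  · exact fun V _ W _ h => Finset.map_injective _ h
  · rw [Finset.disjoint_left]
    intro U h0 h1
    obtain ⟨V, hV, rfl⟩ := Finset.mem_image.1 h0
    obtain ⟨W, hW, h⟩ := Finset.mem_image.1 h1
    obtain ⟨i, hi⟩ := π.nonempty_of_mem_parts hV
    have hmem := (toLex_mem_map_inCopy i 0 0 V).2 ⟨rfl, hi⟩
    rw [← show Finset.map (inCopy 1) W = Finset.map (inCopy 0) V from h,
      toLex_mem_map_inCopy] at hmem
    exact absurd hmem.1 (by simp)

/-- A partition of the doubled set none of whose blocks meets both copies is a union. -/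
theorem exists_eq_unionPartition {τ : Finpartition (Finset.univ : Finset (Doubled n))}
    (h : ∀ i j : Fin n, ¬ SameBlock τ (toLex (i, 0)) (toLex (j, 1))) :
    ∃ π σ, τ = unionPartition π σ ∧
      (∀ i j, SameBlock π i j ↔ SameBlock τ (inCopyEmb 0 i) (inCopyEmb 0 j)) ∧
      (∀ i j, SameBlock σ i j ↔ SameBlock τ (inCopyEmb 1 i) (inCopyEmb 1 j)) := by
  have key : ∀ (c : Fin 2) (i j : Fin n),
      SameBlock (tracePartition ((blockSetoid τ).comap (inCopyEmb c)) Finset.univ) i j ↔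
        SameBlock τ (inCopyEmb c i) (inCopyEmb c j) := by
    intro c i j
    rw [sameBlock_tracePartition, ← blockSetoid_iff _ (Finset.mem_univ _)]
    simp [Setoid.comap_rel]
  refine ⟨_, _, finpartition_ext_sameBlock fun x y => ?_, key 0, key 1⟩
  obtain ⟨⟨i, c⟩, rfl⟩ := toLex.surjective x
  obtain ⟨⟨j, d⟩, rfl⟩ := toLex.surjective y
  rw [sameBlock_unionPartition, key, key]
  fin_cases c <;> fin_cases d
  · simp only [Fin.zero_eta, true_and, zero_ne_one, false_and, or_false]
    exact Iff.rfl
  · simpa using h i j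
  · simpa using fun h' : SameBlock τ (toLex (i, 1)) (toLex (j, 0)) => h j i h'.symm
  · simp only [Fin.mk_one, one_ne_zero, true_and, false_and, false_or]
    exact Iff.rfl

/-- If the contribution of each block meeting both copies vanishes, a sum over the non-crossing
partitions of the doubled set is a sum over compatible pairs. -/
theorem sum_doubled {R : Type*} [CommRing R] (f : Finset (Doubled n) → R)
    (hf : ∀ W i j, toLex (i, 0) ∈ W → toLex (j, 1) ∈ W → f W = 0) :
    ∑ τ : NCOn (Finset.univ : Finset (Doubled n)), ∏ W ∈ τ.1.parts, f W =
      ∑ p : CompatiblePair (Finset.univ : Finset (Fin n)),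
        (∏ V ∈ p.1.1.1.parts, f (V.map (inCopy 0))) *
          ∏ V ∈ p.1.2.1.parts, f (V.map (inCopy 1)) := by
  symm
  refine Finset.sum_of_injOn (fun p => ⟨unionPartition p.1.1.1 p.1.2.1,
    isNonCrossing_unionPartition p.1.1.2 p.1.2.2 p.2⟩) ?_ (by simp) ?_ ?_
  · rintro ⟨⟨⟨π, hπ⟩, ⟨σ, hσ⟩⟩, hc⟩ _ ⟨⟨⟨π', hπ'⟩, ⟨σ', hσ'⟩⟩, hc'⟩ _ h
    have h' : unionPartition π σ = unionPartition π' σ' := congrArg Subtype.val h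
    obtain rfl : π = π' := finpartition_ext_sameBlock fun i j => by
      have h0 := sameBlock_unionPartition π σ i j 0 0
      rw [h', sameBlock_unionPartition] at h0
      simpa using h0.symm
    obtain rfl : σ = σ' := finpartition_ext_sameBlock fun i j => by
      have h0 := sameBlock_unionPartition π σ i j 1 1
      rw [h', sameBlock_unionPartition] at h0
      simpa using h0.symm
    rfl
  · rintro ⟨τ, hτ⟩ _ hnot
    -- A partition outside the image must have a block meeting both copies, so its product vanishes:
    -- without such a block it would be a union, whose parts are non-crossing and compatible.
    by_cases hmix : ∃ i j : Fin n, SameBlock τ (toLex (i, 0)) (toLex (j, 1))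
    · obtain ⟨i, j, W, hW, hi, hj⟩ := hmix
      exact Finset.prod_eq_zero hW (hf W i j hi hj)
    · push Not at hmix
      obtain ⟨π, σ, rfl, hπ, hσ⟩ := exists_eq_unionPartition hmix
      have hnc : ∀ (c : Fin 2) (π' : Finpartition (Finset.univ : Finset (Fin n))),
          (∀ i j, SameBlock π' i j ↔
            SameBlock (unionPartition π σ) (inCopyEmb c i) (inCopyEmb c j)) →
          IsNonCrossing π' := by
        intro c π' h p₁ q₁ p₂ q₂ h1 h2 h3 hp hq
        rw [h] at hp hq ⊢
        exact hτ _ _ _ _ ((inCopyEmb c).lt_iff_lt.2 h1) ((inCopyEmb c).lt_iff_lt.2 h2)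
          ((inCopyEmb c).lt_iff_lt.2 h3) hp hq
      have hπ' := hnc 0 π hπ
      have hσ' := hnc 1 σ hσ
      exact absurd ⟨⟨(⟨π, hπ'⟩, ⟨σ, hσ'⟩),
        compatible_of_isNonCrossing_unionPartition ⟨π, hπ'⟩ ⟨σ, hσ'⟩ hτ⟩, by simp, rfl⟩ hnot
  · intro p _
    exact (prod_unionPartition_parts _ _ _).symm

/-- The order embedding enumerating the doubled set. -/
def doubledEnum (n : ℕ) : Fin (n * 2) ↪o Doubled n :=
  OrderEmbedding.ofStrictMono (fun k => toLex (k.divNat, k.modNat)) fun k l h => by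
    rw [doubled_lt_iff, Fin.lt_def, Fin.lt_def, Fin.ext_iff]
    rw [Fin.lt_def] at h
    simp only [Fin.coe_divNat, Fin.coe_modNat]
    omega

theorem map_doubledEnum (n : ℕ) :
    Finset.univ.map (doubledEnum n).toEmbedding = Finset.univ := by
  rw [← Finset.card_eq_iff_eq_univ, Finset.card_map]
  simp [Doubled, Lex]

theorem prod_doubledEnum {A : Type*} [Monoid A] (x : Doubled n → A) :
    (List.ofFn fun k => x (doubledEnum n k)).prod =
      (List.ofFn fun i => x (toLex (i, 0)) * x (toLex (i, 1))).prod := by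
  rw [List.ofFn_mul, List.prod_flatten, List.map_ofFn]
  congr 2
  funext i
  have h : ∀ (j : Fin 2) (hlt : (i : ℕ) * 2 + j < n * 2),
      doubledEnum n ⟨i * 2 + j, hlt⟩ = toLex (i, j) := by
    intro j hlt
    refine congrArg toLex (Prod.ext (Fin.ext ?_) (Fin.ext ?_))
    · simp only [Fin.coe_divNat]
      omega
    · simp only [Fin.coe_modNat]
      omega
  have h0 : ∀ hlt, doubledEnum n ⟨i * 2, hlt⟩ = toLex (i, 0) := h 0
  have h1 : ∀ hlt, doubledEnum n ⟨i * 2 + 1, hlt⟩ = toLex (i, 1) := h 1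
  simp [h0, h1]

end Doubled

/-! ## Multilinearity of the free cumulants -/

section Multilinear

variable {k A R : Type*} [CommRing k] [Ring A] [Algebra k A] [CommRing R] [Algebra k R]

theorem sumNC_freeCumulant (P : NCProbability k A R) {n : ℕ} (hn : 1 ≤ n) (x : Fin n → A) :
    sumNC (freeCumulant P) n x = P.φ (List.ofFn x).prod :=
  (moment_cumulant_formula P hn x).symm

theorem onSubset_update_of_notMem {n : ℕ} {X R : Type*} (h : (m : ℕ) → (Fin m → X) → R)
    (x : Fin n → X) (i : Fin n) (y : X) {V : Finset (Fin n)} (hi : i ∉ V) :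
    onSubset h (Function.update x i y) V = onSubset h x V := by
  unfold onSubset
  congr 1
  funext j
  refine Function.update_of_ne ?_ _ _
  rintro rfl
  exact hi (Finset.orderEmbOfFin_mem _ _ _)

theorem onSubset_update_of_mem {n : ℕ} {X R : Type*} (h : (m : ℕ) → (Fin m → X) → R)
    (x : Fin n → X) (i : Fin n) {V : Finset (Fin n)} (hi : i ∈ V) :
    ∃ j : Fin V.card, ∀ y, onSubset h (Function.update x i y) V =
      h V.card (Function.update (fun j => x (V.orderEmbOfFin rfl j)) j y) := by
  have : i ∈ Set.range (V.orderEmbOfFin rfl) := by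
    rw [Finset.range_orderEmbOfFin]
    exact hi
  obtain ⟨j, rfl⟩ := this
  refine ⟨j, fun y => congrArg (h V.card) ?_⟩
  exact Function.update_comp_eq_of_injective x (V.orderEmbOfFin rfl).injective j y

/-- The free cumulants are linear in each argument. -/
theorem exists_linear_freeCumulant (P : NCProbability k A R) :
    ∀ (n : ℕ) (x : Fin n → A) (i : Fin n),
      ∃ L : A →ₗ[k] R, ∀ y, freeCumulant P n (Function.update x i y) = L y := by
  intro n
  induction n using Nat.strong_induction_on with
  | _ n ih =>
    intro x i
    have hn : 1 ≤ n := Nat.one_le_iff_ne_zero.2 (by rintro rfl; exact i.elim0)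
    -- Only the block containing `i` depends on `y`, and it has fewer than `n` elements, so the
    -- induction hypothesis applies to that factor.
    have hπ : ∀ π ∈ Finset.univ.erase (⟨⊤, isNonCrossing_top n⟩ : NC n), ∃ L : A →ₗ[k] R,
        ∀ y, ∏ V ∈ π.1.parts, onSubset (freeCumulant P) (Function.update x i y) V = L y := by
      intro π hπ
      have hne : π.1 ≠ ⊤ := fun h => Finset.ne_of_mem_erase hπ (Subtype.ext h)
      obtain ⟨V, hV, hiV⟩ := π.1.exists_mem (Finset.mem_univ i)
      obtain ⟨j, hj⟩ := onSubset_update_of_mem (freeCumulant P) x i hiV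
      obtain ⟨L, hL⟩ := ih _ (card_lt_of_mem_parts_of_ne_top hne hV)
        (fun j => x (V.orderEmbOfFin rfl j)) j
      refine ⟨LinearMap.mulRight k (∏ W ∈ π.1.parts.erase V, onSubset (freeCumulant P) x W) ∘ₗ L,
        fun y => ?_⟩
      rw [← Finset.mul_prod_erase _ _ hV, hj, hL]
      simp only [LinearMap.comp_apply, LinearMap.mulRight_apply]
      congr 1
      refine Finset.prod_congr rfl fun W hW => onSubset_update_of_notMem _ _ _ _ fun hiW => ?_
      rw [Finset.mem_erase] at hW
      exact hW.1 (π.1.eq_of_mem_parts hW.2 hV hiW hiV)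
    choose! L hL using hπ
    refine ⟨P.φ ∘ₗ (MultilinearMap.mkPiAlgebraFin k n A).toLinearMap x i -
      ∑ π ∈ Finset.univ.erase (⟨⊤, isNonCrossing_top n⟩ : NC n), L π, fun y => ?_⟩
    have h := sumNC_freeCumulant P hn (Function.update x i y)
    rw [sumNC_eq_add _ hn] at h
    rw [LinearMap.sub_apply, LinearMap.sum_apply, LinearMap.comp_apply,
      MultilinearMap.toLinearMap_apply, MultilinearMap.mkPiAlgebraFin_apply, ← h,
      Finset.sum_congr rfl fun π hπ => hL π hπ y, add_sub_cancel_right]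

/-- The `n`-th free cumulant as a multilinear map. -/
noncomputable def freeCumulantMultilinear (P : NCProbability k A R) (n : ℕ) :
    MultilinearMap k (fun _ : Fin n => A) R where
  toFun := freeCumulant P n
  map_update_add' x i y z := by
    -- The field allows an arbitrary decidability instance in `Function.update`; it is identified
    -- with the standard one.
    obtain rfl := Subsingleton.elim ‹DecidableEq (Fin n)› (instDecidableEqFin n)
    obtain ⟨L, hL⟩ := exists_linear_freeCumulant P n x i
    simp only [hL, map_add]
  map_update_smul' x i c y := by
    obtain rfl := Subsingleton.elim ‹DecidableEq (Fin n)› (instDecidableEqFin n)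
    obtain ⟨L, hL⟩ := exists_linear_freeCumulant P n x i
    simp only [hL, map_smul]

end Multilinear

/-! ## Sums and products of free tuples -/

section Free

variable {k A R : Type*} [CommRing k] [Ring A] [Algebra k A] [CommRing R] [Algebra k R]

theorem CombinatoriallyFree.mixed_eq_zero {P : NCProbability k A R} {M N : Set A}
    (h : CombinatoriallyFree P ![M, N]) {m : ℕ} {x : Fin m → A}
    {c : Fin m → Prop} (hcM : ∀ j, c j → x j ∈ M) (hcN : ∀ j, ¬ c j → x j ∈ N)
    {p q : Fin m} (hp : c p) (hq : ¬ c q) : freeCumulant P m x = 0 := by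
  classical
  have hpq : p ≠ q := by rintro rfl; exact hq hp
  refine h m x (fun j => if c j then 0 else 1) (fun j => ?_) ?_
  · by_cases hj : c j
    · simpa [hj] using hcM j hj
    · simpa [hj] using hcN j hj
  · rcases lt_or_gt_of_ne hpq with hlt | hlt
    · exact ⟨p, q, hlt, by simp [hp, hq]⟩
    · exact ⟨q, p, hlt, by simp [hp, hq]⟩

variable {s : ℕ} {a b : Fin s → A}

theorem freeCumulant_add_of_free {P : NCProbability k A R}
    (h : CombinatoriallyFree P ![Set.range a, Set.range b]) {n : ℕ} (hn : 1 ≤ n)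
    (w : Fin n → Fin s) :
    freeCumulant P n (fun j => (a + b) (w j)) =
      freeCumulant P n (fun j => a (w j)) + freeCumulant P n (fun j => b (w j)) := by
  classical
  have hadd := (freeCumulantMultilinear P n).map_add_univ (fun j => a (w j)) (fun j => b (w j))
  change freeCumulant P n (fun j => (a + b) (w j)) = ∑ t : Finset (Fin n),
    freeCumulant P n (t.piecewise (fun j => a (w j)) fun j => b (w j)) at hadd
  have hne : (Finset.univ : Finset (Fin n)) ≠ ∅ :=
    (Finset.univ_nonempty_iff.2 ⟨⟨0, hn⟩⟩).ne_empty
  rw [hadd, Finset.sum_eq_add Finset.univ ∅ hne]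
  · simp
  · rintro t - ⟨ht1, ht2⟩
    obtain ⟨p, hp⟩ := Finset.nonempty_iff_ne_empty.2 ht2
    obtain ⟨q, hq⟩ : ∃ q, q ∉ t := by
      by_contra hcon
      push Not at hcon
      exact ht1 (Finset.eq_univ_of_forall hcon)
    exact h.mixed_eq_zero (c := fun j => j ∈ t)
      (fun j hj => ⟨w j, by simp [hj]⟩) (fun j hj => ⟨w j, by simp [hj]⟩) hp hq
  · simp
  · simp

/-- The families take words of indices rather than elements of `A`, so that the cumulants of `a` and
those of `b` have the same arguments, as `boxNC` requires. -/
theorem freeCumulant_mul_of_free {P : NCProbability k A R}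
    (h : CombinatoriallyFree P ![Set.range a, Set.range b]) {n : ℕ} (hn : 1 ≤ n)
    (w : Fin n → Fin s) :
    freeCumulant P n (fun j => (a * b) (w j)) =
      boxNC (fun m v => freeCumulant P m fun j => a (v j))
        (fun m v => freeCumulant P m fun j => b (v j)) n w := by
  refine eq_of_sumNC_eq (h := fun m v => freeCumulant P m fun j => (a * b) (v j))
    (fun n hn w => ?_) n hn w
  have hL : sumNC (fun m v => freeCumulant P m fun j => (a * b) (v j)) n w =
      sumNC (freeCumulant P) n (fun j => (a * b) (w j)) := rfl
  -- The alternating word $a_{i_1},b_{i_1},\dots,a_{i_n},b_{i_n}$, indexed by the doubled set.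
  set c : Doubled n → A := fun x =>
    if (ofLex x).2 = 0 then a (w (ofLex x).1) else b (w (ofLex x).1) with hc
  have hmoment : P.φ (List.ofFn fun j => (a * b) (w j)).prod =
      ∑ τ : NCOn (Finset.univ : Finset (Doubled n)), ∏ W ∈ τ.1.parts,
        onSubset (freeCumulant P) c W := by
    rw [← onSubset_sumNC, onSubset_eq _ _ (doubledEnum n) (map_doubledEnum n),
      sumNC_freeCumulant P (by omega), prod_doubledEnum]
    simp [hc]
  rw [hL, sumNC_freeCumulant P hn, hmoment, sumNC_boxNC, sum_doubled]
  · refine Finset.sum_congr rfl fun p _ => ?_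
    simp only [← inCopyEmb_toEmbedding, onSubset_map]
    rfl
  -- A block meeting both copies carries a cumulant with an entry from each of the two free sets.
  · intro W i j hi hj
    have hmem : ∀ x ∈ W, ∃ l, W.orderEmbOfFin rfl l = x := fun x hx => by
      have : x ∈ Set.range (W.orderEmbOfFin rfl) := by
        rw [Finset.range_orderEmbOfFin]
        exact hx
      exact this
    obtain ⟨p, hp⟩ := hmem _ hi
    obtain ⟨q, hq⟩ := hmem _ hj
    refine h.mixed_eq_zero (c := fun l => (ofLex (W.orderEmbOfFin rfl l)).2 = 0)
      (fun l hl => ⟨_, (if_pos hl).symm⟩) (fun l hl => ⟨_, (if_neg hl).symm⟩)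
      (p := p) (q := q) ?_ ?_
    · rw [hp]; rfl
    · rw [hq]; simp

end Free

/-! ### Passage from cumulant families to coefficients of series -/

section RTransform

variable {k A R : Type*} [CommRing k] [Ring A] [Algebra k A] [CommRing R] [Algebra k R]

theorem coeffAlong_RTransform (P : NCProbability k A R) {s : ℕ} (a : Fin s → A)
    (w : List (Fin s)) (π : NC w.length) :
    coeffAlong (RTransform P a) w π =
      ∏ V ∈ π.1.parts, onSubset (fun m v => freeCumulant P m fun j => a (v j)) w.get V := by
  refine Finset.prod_congr rfl fun V hV => ?_
  -- Blocks are non-empty, so the default coefficient $0$ at the empty word is never used.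
  have hpos : 0 < V.card := Finset.card_pos.2 (π.1.nonempty_of_mem_parts hV)
  have hlist : ∀ (m : ℕ) (v : Fin m → Fin s), freeCumulant P (List.ofFn v).length
      (fun j => a ((List.ofFn v).get j)) = freeCumulant P m fun j => a (v j) := by
    intro m v
    have hcast : ∀ (m' : ℕ) (hm : m' = m) (x : Fin m' → A) (y : Fin m → A),
        (∀ j, x j = y (Fin.cast hm j)) → freeCumulant P m' x = freeCumulant P m y := by
      rintro m' rfl x y hxy
      exact congrArg _ (funext hxy)
    exact hcast _ List.length_ofFn _ _ fun j => by rw [List.get_ofFn]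
  have hne : List.ofFn (restrictTo w.get V) ≠ [] := by
    intro h
    rw [List.ofFn_eq_nil_iff] at h
    omega
  simp only [RTransform, if_neg hne]
  exact hlist _ _

end RTransform

theorem mainTheorem6 {k A R : Type*} [CommRing k] [Ring A] [Algebra k A] [CommRing R]
    [Algebra k R] (P : NCProbability k A R) (s : ℕ) (a b : Fin s → A)
    (hfree : CombinatoriallyFree P ![Set.range a, Set.range b]) :
    RTransform P (a + b) = RTransform P a + RTransform P b ∧
      RTransform P (a * b) = boxedConvolution (RTransform P a) (RTransform P b) := by
  constructor
  · refine Subtype.ext (funext fun w => ?_)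
    rw [Submodule.coe_add, Pi.add_apply]
    by_cases hw : w = []
    · simp [RTransform, hw]
    · simp only [RTransform, if_neg hw]
      exact freeCumulant_add_of_free hfree (List.length_pos_iff.2 hw) _
  · refine Subtype.ext (funext fun w => ?_)
    by_cases hw : w = []
    · simp [RTransform, boxedConvolution, hw]
    · simp only [boxedConvolution, if_neg hw, coeffAlong_RTransform]
      simp only [RTransform, if_neg hw]
      exact freeCumulant_mul_of_free hfree (List.length_pos_iff.2 hw) _
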